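/- Let $\beta,\gamma\in\mathbb{C}$ with $\gamma\notin\mathbb{Z}$ and $\eta\in(0,\frac{\pi}{2})$ be fixed. For $\alpha\in\mathbb{C}$ with $\alpha-\beta,\ \gamma-\alpha-\beta\notin\mathbb{Z}$ consider the following solutions of the Gauss equation $x(1-x)y''+(\gamma-(\alpha+\beta+1)x)y'-\alpha\beta y=0$: $$y_1^{(\infty)}(x)=(-x)^{-\alpha}\,{}_2F_1(\alpha,\alpha+1-\gamma;\alpha+1-\beta;x^{-1}),\qquad y_2^{(\infty)}(x)=(-x)^{-\beta}\,{}_2F_1(\beta,\beta+1-\gamma;\beta+1-\alpha;x^{-1})$$ for $|x|>1$, continued analytically to $|\arg(-x)|<\pi$, and $$y_1^{(1)}(x)=(1-x)^{\gamma-\alpha-\beta}\,{}_2F_1(\gamma-\alpha,\gamma-\beta;\gamma+1-\alpha-\beta;1-x),\qquad y_2^{(1)}(x)={}_2F_1(\alpha,\beta;\alpha+\beta+1-\gamma;1-x)$$ for $|1-x|<1$, continued analytically to $|\arg x|<\pi$, $|\arg(1-x)|<\pi$ (all powers being principal). For $k\in\mathbb{Z}$ let $\tilde y_j^{(\infty,k)}(z)$,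 $j=1,2$, be the sectorial solutions of the Kummer equation $z\tilde y''+(\gamma-z)\tilde y'-\beta\tilde y=0$ at infinity: they are the solutions analytic in the sector $-\frac{\pi}{2}<\arg z-k\pi<\frac{3\pi}{2}$ of the Riemann surface of the logarithm with the asymptotic expansions $$\tilde y_1^{(\infty,k)}(z)\sim e^z z^{\beta-\gamma}\sum_{n\ge0}\frac{(\gamma-\beta)_n(1-\beta)_n}{n!}z^{-n},\qquad \tilde y_2^{(\infty,k)}(z)\sim -z^{-\beta}\sum_{n\ge0}(-1)^n\frac{(\beta)_n(\beta+1-\gamma)_n}{n!}z^{-n}$$ as $z\to\infty$, uniformly in closed subsectors. Let $\widetilde{\mathscr S}_k=\{z:\ \eta-\frac{\pi}{2}<\arg z-k\pi<\frac{3\pi}{2}-\eta\}$ and $$\sigma_\alpha(\alpha)=\Big\{z:\ \big|1-\tfrac{\alpha}{z}\big|<|\alpha|^2,\ \big|\arg\tfrac{z}{\alpha}\big|<\pi-\eta,\ \big|\arg(1-\tfrac{z}{\alpha})\big|<\pi-\eta\Big\},$$ $$\sigma_\infty(\alpha)=\Big\{z:\ \big|\arg(-\tfrac{z}{\alpha})\big|<\pi-\eta,\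 \big|\arg(1-\tfrac{z}{\alpha})\big|<\pi-\eta\Big\},$$ where $\arg\frac{z}{\alpha}=\arg z-\arg\alpha$, $\arg(-\frac{z}{\alpha})=\arg z-\arg\alpha-\pi$, and $\arg(1-\frac z\alpha)$ is principal. Suppose that the scalars $k_{j,\infty}^{\pm}(\alpha)$ and $k_{j,1}^{\pm}(\alpha)$, $j=1,2$, satisfy $$\lim_{\arg\alpha=-\frac{\pi}{2}}y_j^{(1)}(z\alpha^{-1})\big|_{z\in\sigma_\alpha(\alpha)}k_{j,1}^-(\alpha)=\tilde y_j^{(\infty,-1)}(z),\qquad \lim_{\arg\alpha=-\frac{\pi}{2}}y_j^{(\infty)}(z\alpha^{-1})\big|_{z\in\sigma_\infty(\alpha)}k_{j,\infty}^-(\alpha)=\tilde y_j^{(\infty,0)}(z),$$ $$\lim_{\arg\alpha=\frac{\pi}{2}}y_j^{(1)}(z\alpha^{-1})\big|_{z\in\sigma_\alpha(\alpha)}k_{j,1}^+(\alpha)=\tilde y_j^{(\infty,0)}(z),\qquad \lim_{\arg\alpha=\frac{\pi}{2}}y_j^{(\infty)}(z\alpha^{-1})\big|_{z\in\sigma_\infty(\alpha)}k_{j,\infty}^+(\alpha)=\tilde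 y_j^{(\infty,1)}(z),$$ as $\alpha\to\infty$ along the indicated rays, uniformly for $z$ in compact subsets of $\widetilde{\mathscr S}_{-1}$, $\widetilde{\mathscr S}_0$, $\widetilde{\mathscr S}_0$, $\widetilde{\mathscr S}_1$ respectively. Then, as $\alpha\to\infty$ with $\arg\alpha=\pm\frac{\pi}{2}$ (for each of the two signs), $$k_{1,\infty}^{\pm}(\alpha)(-\alpha)^{\gamma-\beta}\to1,\quad -k_{2,\infty}^{\pm}(\alpha)(-\alpha)^{\beta}\to1,\quad k_{1,1}^{\pm}(\alpha)\,\alpha^{\gamma-\beta}\to1,\quad -k_{2,1}^{\pm}(\alpha)\,\alpha^{\beta}\to1,$$ where $\arg(-\alpha)=\arg\alpha+\pi$. -/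

import Mathlib

open Complex Filter Topology Asymptotics

/-! Functions of `z` on the Riemann surface of the logarithm are written in the coordinate
`ζ = log z`: a point of the surface is a complex number `ζ`, it lies over `z = exp ζ`, it has
`|z| = exp (re ζ)` and `arg z = im ζ`, and `z ^ s` is `exp (s * ζ)`. -/

noncomputable section

namespace Confluence

/-- The filter `α → ∞` along the ray `arg α = θ`. -/
def ray (θ : ℝ) : Filter ℂ := cocompact ℂ ⊓ 𝓟 {α : ℂ | α.arg = θ}

/-- `(-α) ^ s`, where the argument of `-α` is `arg α + π` (so that it is `π / 2` if
`arg α = -π / 2` and `3 * π / 2` if `arg α = π / 2`). -/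
def negPow (α s : ℂ) : ℂ := exp (s * (log α + Real.pi * I))

/-! ### Gauss equation -/

/-- The two local solutions of the Gauss equation at `x = ∞`, given by series for `1 < ‖x‖`. -/
def gaussInfLocal (α β γ : ℂ) : Fin 2 → ℂ → ℂ :=
  ![fun x => (-x) ^ (-α) * ordinaryHypergeometric α (α + 1 - γ) (α + 1 - β) x⁻¹,
    fun x => (-x) ^ (-β) * ordinaryHypergeometric β (β + 1 - γ) (β + 1 - α) x⁻¹]

/-- The two local solutions of the Gauss equation at `x = 1`, given by series for
`‖1 - x‖ < 1`. -/
def gaussOneLocal (α β γ : ℂ) : Fin 2 → ℂ → ℂ :=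
  ![fun x => (1 - x) ^ (γ - α - β) *
      ordinaryHypergeometric (γ - α) (γ - β) (γ + 1 - α - β) (1 - x),
    fun x => ordinaryHypergeometric α β (α + β + 1 - γ) (1 - x)]

/-- `ℂ` without the half-line `[0, ∞)`, that is `|arg (-x)| < π`. -/
def domInf : Set ℂ := {x | -x ∈ slitPlane}

/-- `ℂ` without `(-∞, 0]` and `[1, ∞)`, that is `|arg x| < π` and `|arg (1 - x)| < π`. -/
def domOne : Set ℂ := {x | x ∈ slitPlane ∧ 1 - x ∈ slitPlane}

open Classical in
/-- The analytic continuation to the domain `V` of the function `f`, which is given on `U ⊆ V`.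
On `V` it is unique if `V` is open and connected and `U` is open and non-empty; the value is the
zero function if `f` has no analytic continuation to `V`. -/
def continuation (U V : Set ℂ) (f : ℂ → ℂ) : ℂ → ℂ :=
  if h : ∃ g : ℂ → ℂ, DifferentiableOn ℂ g V ∧ Set.EqOn g f U then h.choose else 0

/-- The solutions `y_j^(∞)` of the Gauss equation, continued from `1 < ‖x‖` to
`|arg (-x)| < π`. -/
def gaussInf (α β γ : ℂ) (j : Fin 2) : ℂ → ℂ :=
  continuation (domInf ∩ {x | 1 < ‖x‖}) domInf (gaussInfLocal α β γ j)

/-- The solutions `y_j^(1)` of the Gauss equation, continued from `‖1 - x‖ < 1` to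
`|arg x| < π`, `|arg (1 - x)| < π`. -/
def gaussOne (α β γ : ℂ) (j : Fin 2) : ℂ → ℂ :=
  continuation (domOne ∩ {x | ‖1 - x‖ < 1}) domOne (gaussOneLocal α β γ j)

/-! ### Kummer equation -/

/-- The derivative with respect to `z = exp ζ` of a function given in the coordinate `ζ`. -/
def dz (f : ℂ → ℂ) (ζ : ℂ) : ℂ := exp (-ζ) * deriv f ζ

/-- The sector `-π/2 < arg z - k π < 3π/2` on the Riemann surface of the logarithm. -/
def sectorSigma (k : ℤ) : Set ℂ :=
  {ζ | ζ.im - k * Real.pi ∈ Set.Ioo (-(Real.pi / 2)) (3 * Real.pi / 2)}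

/-- The closed subsector `δ - π/2 ≤ arg z - k π ≤ 3π/2 - δ`. -/
def closedSubsector (k : ℤ) (δ : ℝ) : Set ℂ :=
  {ζ | ζ.im - k * Real.pi ∈ Set.Icc (δ - Real.pi / 2) (3 * Real.pi / 2 - δ)}

/-- The filter `z → ∞` within the closed subsector. -/
def atInfty (k : ℤ) (δ : ℝ) : Filter ℂ := comap Complex.re atTop ⊓ 𝓟 (closedSubsector k δ)

/-- Leading factors `e^z z^(β-γ)` and `-z^(-β)` of the formal solutions at infinity. -/
def formalFactor (β γ : ℂ) : Fin 2 → ℂ → ℂ :=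
  ![fun ζ => exp (exp ζ) * exp ((β - γ) * ζ), fun ζ => -exp (-β * ζ)]

/-- Coefficients of `z^(-n)` in the formal series `₂F₀(γ-β, 1-β; 1/z)` and
`₂F₀(β, β+1-γ; -1/z)`. -/
def formalCoeff (β γ : ℂ) : Fin 2 → ℕ → ℂ :=
  ![fun n => (ascPochhammer ℂ n).eval (γ - β) * (ascPochhammer ℂ n).eval (1 - β) / n.factorial,
    fun n => (-1) ^ n * (ascPochhammer ℂ n).eval β * (ascPochhammer ℂ n).eval (β + 1 - γ) /
      n.factorial]

/-- `f` is the sectorial solution `ỹ_j^(∞,k)` of the Kummer equation: it is analytic in the sector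
`-π/2 < arg z - k π < 3π/2`, solves `z y'' + (γ - z) y' - β y = 0` there, and has the `j`-th formal
solution as its asymptotic expansion as `z → ∞`, uniformly in every closed subsector. -/
structure IsKummerSectorial (β γ : ℂ) (j : Fin 2) (k : ℤ) (f : ℂ → ℂ) : Prop where
  analytic : DifferentiableOn ℂ f (sectorSigma k)
  equation : ∀ ζ ∈ sectorSigma k,
    exp ζ * dz (dz f) ζ + (γ - exp ζ) * dz f ζ - β * f ζ = 0
  expansion : ∀ δ : ℝ, 0 < δ → ∀ N : ℕ,
    (fun ζ => f ζ / formalFactor β γ j ζ -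
        ∑ n ∈ Finset.range N, formalCoeff β γ j n * exp (-(n : ℂ) * ζ))
      =O[atInfty k δ] fun ζ => Real.exp (-(N : ℝ) * ζ.re)

/-! ### Confluence -/

/-- The sector `η - π/2 < arg z - k π < 3π/2 - η`. -/
def sectorS (η : ℝ) (k : ℤ) : Set ℂ :=
  {ζ | ζ.im - k * Real.pi ∈ Set.Ioo (η - Real.pi / 2) (3 * Real.pi / 2 - η)}

/-- The sector `σ_α(α)`, with `arg (z/α) = arg z - arg α`. -/
def sigmaOne (η : ℝ) (α : ℂ) : Set ℂ :=
  {ζ | ‖1 - α / exp ζ‖ < ‖α‖ ^ 2 ∧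
    ζ.im - α.arg ∈ Set.Ioo (η - Real.pi) (Real.pi - η) ∧
    (1 - exp ζ / α).arg ∈ Set.Ioo (η - Real.pi) (Real.pi - η)}

/-- The sector `σ_∞(α)`, with `arg (-z/α) = arg z - arg α - π`. -/
def sigmaInf (η : ℝ) (α : ℂ) : Set ℂ :=
  {ζ | ζ.im - α.arg - Real.pi ∈ Set.Ioo (η - Real.pi) (Real.pi - η) ∧
    (1 - exp ζ / α).arg ∈ Set.Ioo (η - Real.pi) (Real.pi - η)}

/-- `y (z/α) κ(α) → ỹ(z)`, where `z` is restricted to `σ(α)`, as `α → ∞` along `arg α = θ`,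
uniformly for `z` in the compact subsets of the sector `S`. -/
def ScaledLimit (θ : ℝ) (σ : ℂ → Set ℂ) (S : Set ℂ) (y : ℂ → ℂ → ℂ) (κ : ℂ → ℂ)
    (ytilde : ℂ → ℂ) : Prop :=
  ∀ K : Set ℂ, K ⊆ S → IsCompact K → ∀ ε : ℝ, 0 < ε →
    ∀ᶠ α in ray θ, ∀ ζ ∈ K, ζ ∈ σ α → ‖y α (exp ζ / α) * κ α - ytilde ζ‖ < ε

end Confluence

end

/-!
The scalars are found by evaluating the limits at points `z` far out on the rays on which the
solutions in question are recessive. There Euler's and Pfaff's transformations bring the solutions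
of the Gauss equation, with `x = z / α`, into the form of elementary factors times a
hypergeometric function whose first two parameters do not depend on `α`:
* `y₂^(∞) = (-x)^(-β) F(β, β+1-γ; β+1-α; 1/x)`,
* `y₂^(1) = x^(-β) F(β, β+1-γ; α+β+1-γ; 1 - 1/x)`,
* `y₁^(∞) = (1-x)^(γ-α-β) (-x)^(β-γ) F(1-β, γ-β; α+1-β; 1/x)`,
* `y₁^(1) = (1-x)^(γ-α-β) x^(β-γ) F(1-β, γ-β; γ+1-α-β; 1 - 1/x)`.
The elementary factors are, up to the power of `α` in the claim, the leading factors of the formal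
solutions of the Kummer equation, because `(1 - z/α)^(-α) → e^z`. So it is enough to know that the
hypergeometric factor is `1 + O(1/|z|)` for all large `α`, uniformly in `α`: at each such `z` the
product of scalar and power then has all its limit points within `O(1/|z|)` of `1`, and `|z|` is
arbitrary. The limit of the hypergeometric factor is not needed, nor are connection formulas.

The estimate is `exists_hyp_sub_one_bound`. The third parameter `c` behaves like `± α` and is almost
imaginary, and the variable `w` behaves like `-c / |z|`. In a fixed disc the power series gives
`F = 1 + O(1/|c|)` and `F' = O(1/|c|)`. Along the ray from `0` to `w` the Gauss equation is a first
order equation for `F'` with a damping rate proportional to `|c|`, so `F'` stays `O(1/|c|)`, and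
integration over a length `O(|c| / |z|)` gives the claim. For `z > 0` (second solution) and `z < 0`
(first solution) `im c` and `im w` have opposite signs, which is what makes the rate positive.

The solutions of the Gauss equation are defined through analytic continuation, so the hypergeometric
series has to be continued to the plane cut along `[1, ∞)`. In the coordinate `u` with `w = -e^u` the
Gauss equation is regular in the convex strip `|im u| < π`, where Picard iteration solves it globally
(`exists_linear_system_solution`). Euler's and Pfaff's transformations follow from uniqueness of the
solution that is analytic at `0` with value `1` (`eqOn_hyp_of_gaussOp`).
-/

namespace Confluence

/-! ### Linear differential equations on convex domains -/

section LinearODE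

variable {E : Type*} [NormedAddCommGroup E] [NormedSpace ℂ E] {Ω : Set ℂ} {A : ℂ → E →L[ℂ] E}
  {p : ℂ}

lemma hasDerivAt_lineMap {f : ℂ → E} {f' : E} {x : ℂ} {t : ℝ}
    (hf : HasDerivAt f f' (AffineMap.lineMap p x (t : ℂ))) :
    HasDerivAt (fun s : ℝ => f (AffineMap.lineMap p x (s : ℂ))) ((x - p) • f') t := by
  have h : HasDerivAt (fun s : ℂ => (AffineMap.lineMap p x s : ℂ)) (x - p) (t : ℂ) :=
    AffineMap.hasDerivAt_lineMap
  exact hf.scomp t h.comp_ofReal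

lemma lineMap_ofReal_mem (hΩ : Convex ℝ Ω) (hp : p ∈ Ω) {x : ℂ} (hx : x ∈ Ω) {t : ℝ}
    (ht : t ∈ Set.Icc (0 : ℝ) 1) : (AffineMap.lineMap p x (t : ℂ) : ℂ) ∈ Ω := by
  have h := hΩ.lineMap_mem hp hx ht
  have h' : (AffineMap.lineMap p x (t : ℂ) : ℂ) = AffineMap.lineMap p x t := by
    simp [AffineMap.lineMap_apply]
  rwa [h']

/-- The union of the segments from `p` to the points of a small disc around `x` is convex and
compact, so that a continuous coefficient is bounded on it. -/
lemma exists_bound_near (hΩ : Convex ℝ Ω) (ho : IsOpen Ω) (hA : ContinuousOn A Ω) (hp : p ∈ Ω)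
    {x : ℂ} (hx : x ∈ Ω) : ∃ K M ε : ℝ, ∃ S : Set ℂ, 0 < ε ∧ 0 ≤ M ∧ Convex ℝ S ∧ S ⊆ Ω ∧ p ∈ S ∧
      Metric.ball x ε ⊆ S ∧ (∀ y ∈ S, ‖A y‖ ≤ M) ∧ ∀ y ∈ S, ‖y - p‖ ≤ K := by
  obtain ⟨ε, hε, hball⟩ := Metric.nhds_basis_closedBall.mem_iff.1 (ho.mem_nhds hx)
  set S : Set ℂ := convexJoin ℝ {p} (Metric.closedBall x ε) with hS
  have himage : S = (fun r : ℝ × ℂ => AffineMap.lineMap p r.2 r.1) ''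
      (Set.Icc (0 : ℝ) 1 ×ˢ Metric.closedBall x ε) := by
    ext y
    simp only [hS, convexJoin_singleton_left, segment_eq_image_lineMap, Set.mem_iUnion,
      Set.mem_image, Set.mem_prod, Prod.exists, exists_prop]
    exact ⟨fun ⟨b, hb, t, ht, h⟩ => ⟨t, b, ⟨ht, hb⟩, h⟩,
      fun ⟨t, b, ⟨ht, hb⟩, h⟩ => ⟨b, hb, t, ht, h⟩⟩
  have hcomp : IsCompact S := by
    rw [himage]
    refine (isCompact_Icc.prod (isCompact_closedBall x ε)).image ?_
    simp only [AffineMap.lineMap_apply_module]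
    fun_prop
  have hconv : Convex ℝ S := (convex_singleton p).convexJoin (convex_closedBall x ε)
  have hsub : S ⊆ Ω :=
    convexJoin_subset (Set.singleton_subset_iff.2 hp) hball hΩ
  have hxS : Metric.closedBall x ε ⊆ S := subset_convexJoin_right (Set.singleton_nonempty p)
  have hpS : p ∈ S :=
    subset_convexJoin_left ⟨x, Metric.mem_closedBall_self hε.le⟩ rfl
  obtain ⟨M, hM⟩ := hcomp.exists_bound_of_continuousOn (hA.mono hsub)
  obtain ⟨K, hK⟩ := hcomp.exists_bound_of_continuousOn (f := fun y => y - p) (by fun_prop)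
  exact ⟨K, M, ε, S, hε, (norm_nonneg _).trans (hM p hpS), hconv, hsub, hpS,
    Metric.ball_subset_closedBall.trans hxS, hM, hK⟩

lemma exists_primitive [CompleteSpace E] (hΩ : Convex ℝ Ω) (ho : IsOpen Ω) {f : ℂ → E}
    (hf : DifferentiableOn ℂ f Ω) (p : ℂ) :
    ∃ g : ℂ → E, g p = 0 ∧ ∀ x ∈ Ω, HasDerivAt g (f x) x := by
  obtain ⟨g, hg⟩ := hΩ.exists_forall_hasDerivWithinAt hf
  exact ⟨fun x => g x - g p, by simp,
    fun x hx => ((hg x hx).hasDerivAt (ho.mem_nhds hx)).sub_const _⟩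

/-- Picard iteration: a holomorphic linear system on a convex domain has a solution on the whole
domain. -/
theorem exists_linear_system_solution [CompleteSpace E] (hΩ : Convex ℝ Ω) (ho : IsOpen Ω)
    (hA : DifferentiableOn ℂ A Ω) (hp : p ∈ Ω) (v : E) :
    ∃ u : ℂ → E, u p = v ∧ ∀ x ∈ Ω, HasDerivAt u (A x (u x)) x := by
  have step : ∀ f : {f : ℂ → E // DifferentiableOn ℂ f Ω},
      ∃ g : {f : ℂ → E // DifferentiableOn ℂ f Ω}, g.1 p = 0 ∧
        ∀ x ∈ Ω, HasDerivAt g.1 (A x (f.1 x)) x := by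
    intro f
    obtain ⟨g, hg0, hg⟩ := exists_primitive hΩ ho (hA.clm_apply f.2) p
    exact ⟨⟨g, fun x hx => (hg x hx).differentiableAt.differentiableWithinAt⟩, hg0, hg⟩
  choose T hT0 hT using step
  let U : ℕ → {f : ℂ → E // DifferentiableOn ℂ f Ω} := fun n =>
    Nat.rec ⟨fun _ => v, differentiableOn_const v⟩ (fun _ f => T f) n
  have hU0 : (U 0).1 = fun _ => v := rfl
  have hUs : ∀ n, U (n + 1) = T (U n) := fun n => rfl
  refine ⟨fun x => ∑' n, (U n).1 x, ?_, ?_⟩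
  · change ∑' n, (U n).1 p = v
    rw [tsum_eq_single 0]
    · rfl
    · intro n hn
      obtain ⟨m, rfl⟩ := Nat.exists_eq_succ_of_ne_zero hn
      rw [Nat.succ_eq_add_one, hUs]
      exact hT0 _
  intro x hx
  obtain ⟨K, M, ε, S, hε, hM, hSc, hSΩ, hpS, hball, hAM, hK⟩ :=
    exists_bound_near hΩ ho hA.continuousOn hp hx
  -- The factorials come from integrating the bound for the previous iterate along the segment.
  have bound : ∀ n, ∀ y ∈ S, ‖(U n).1 y‖ ≤ ‖v‖ * ((M * ‖y - p‖) ^ n / n.factorial) := by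
    intro n
    induction n with
    | zero => intro y hy; simp [hU0]
    | succ n ih =>
      intro y hy
      have hmem : ∀ t ∈ Set.Icc (0 : ℝ) 1, (AffineMap.lineMap p y (t : ℂ) : ℂ) ∈ S :=
        fun t ht => lineMap_ofReal_mem hSc hpS hy ht
      have hder : ∀ t ∈ Set.Icc (0 : ℝ) 1, HasDerivAt
          (fun s : ℝ => (U (n + 1)).1 (AffineMap.lineMap p y (s : ℂ)))
          ((y - p) • A (AffineMap.lineMap p y (t : ℂ)) ((U n).1 (AffineMap.lineMap p y (t : ℂ)))) t :=
        fun t ht => hasDerivAt_lineMap (hT (U n) _ (hSΩ (hmem t ht)))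
      have hB : ∀ t : ℝ, HasDerivAt
          (fun t : ℝ => ‖v‖ * ((M * ‖y - p‖) ^ (n + 1) / (n + 1).factorial) * t ^ (n + 1))
          (‖v‖ * ((M * ‖y - p‖) ^ (n + 1) / n.factorial) * t ^ n) t := by
        intro t
        have h := (hasDerivAt_pow (n + 1) t).const_mul
          (‖v‖ * ((M * ‖y - p‖) ^ (n + 1) / (n + 1).factorial))
        convert! h using 1
        rw [Nat.factorial_succ]
        have : (n.factorial : ℝ) ≠ 0 := by positivity
        push_cast
        field_simp
      have key := image_norm_le_of_norm_deriv_right_le_deriv_boundary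
        (f := fun s : ℝ => (U (n + 1)).1 (AffineMap.lineMap p y (s : ℂ))) (a := 0) (b := 1)
        (fun t ht => (hder t ht).continuousAt.continuousWithinAt)
        (fun t ht => (hder t ⟨ht.1, ht.2.le⟩).hasDerivWithinAt)
        (by simp [hUs, hT0]) hB ?_ (Set.right_mem_Icc.2 zero_le_one)
      · simpa using key
      · intro t ht
        have ht' : t ∈ Set.Icc (0 : ℝ) 1 := ⟨ht.1, ht.2.le⟩
        rw [norm_smul]
        have h1 := ih _ (hmem t ht')
        have h2 : ‖(AffineMap.lineMap p y (t : ℂ) : ℂ) - p‖ = t * ‖y - p‖ := by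
          simp [AffineMap.lineMap_apply, abs_of_nonneg ht.1]
        rw [h2] at h1
        calc ‖y - p‖ * ‖A _ ((U n).1 (AffineMap.lineMap p y (t : ℂ)))‖
            ≤ ‖y - p‖ * (M * (‖v‖ * ((M * (t * ‖y - p‖)) ^ n / n.factorial))) := by
              gcongr
              exact ((A _).le_opNorm _).trans (mul_le_mul (hAM _ (hmem t ht')) h1
                (norm_nonneg _) hM)
          _ = _ := by rw [mul_pow, mul_pow, mul_pow]; ring
  have hballΩ : Metric.ball x ε ⊆ Ω := hball.trans hSΩ
  have hxb : x ∈ Metric.ball x ε := Metric.mem_ball_self hε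
  have hsum : Summable fun n : ℕ => ‖v‖ * ((M * K) ^ n / n.factorial) :=
    (Real.summable_pow_div_factorial _).mul_left _
  have hle : ∀ (n : ℕ) (w : ℂ), w ∈ Metric.ball x ε →
      ‖(U n).1 w‖ ≤ ‖v‖ * ((M * K) ^ n / n.factorial) := by
    intro n w hw
    refine (bound n w (hball hw)).trans ?_
    gcongr
    exact hK w (hball hw)
  have hdU : ∀ n, DifferentiableOn ℂ (U n).1 (Metric.ball x ε) := fun n => (U n).2.mono hballΩ
  have hd : DifferentiableAt ℂ (fun w => ∑' n, (U n).1 w) x :=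
    (differentiableOn_tsum_of_summable_norm hsum hdU Metric.isOpen_ball hle).differentiableAt
      (Metric.isOpen_ball.mem_nhds hxb)
  have hds := hasSum_deriv_of_summable_norm hsum hdU Metric.isOpen_ball hle hxb
  have hs : HasSum (fun n => (U n).1 x) (∑' n, (U n).1 x) :=
    (Summable.of_norm_bounded hsum fun n => hle n x hxb).hasSum
  have hs' : HasSum (fun n => deriv (U (n + 1)).1 x) (A x (∑' n, (U n).1 x)) := by
    have h := hs.mapL (A x)
    refine h.congr_fun ?_
    intro n
    exact (hT (U n) x hx).deriv
  have h0 : deriv (U 0).1 x = 0 := by rw [hU0]; simp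
  have hs'' := (hasSum_nat_add_iff' 1).2 hds
  simp only [Finset.sum_range_one, h0, sub_zero] at hs''
  have := hs''.unique hs'
  rw [← this]
  exact hd.hasDerivAt

/-- Solutions of a linear system on a convex domain are determined by their value at a point. -/
theorem linear_system_solution_unique (hΩ : Convex ℝ Ω) (ho : IsOpen Ω)
    (hA : ContinuousOn A Ω) (hp : p ∈ Ω) {u v : ℂ → E}
    (hu : ∀ x ∈ Ω, HasDerivAt u (A x (u x)) x) (hv : ∀ x ∈ Ω, HasDerivAt v (A x (v x)) x)
    (h0 : u p = v p) : Set.EqOn u v Ω := by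
  intro x hx
  obtain ⟨K, M, ε, S, hε, hM, hSc, hSΩ, hpS, hball, hAM, hK⟩ := exists_bound_near hΩ ho hA hp hx
  have hmem : ∀ t ∈ Set.Icc (0 : ℝ) 1, (AffineMap.lineMap p x (t : ℂ) : ℂ) ∈ S :=
    fun t ht => lineMap_ofReal_mem hSc hpS (hball (Metric.mem_ball_self hε)) ht
  have hder : ∀ t ∈ Set.Icc (0 : ℝ) 1, HasDerivAt
      (fun s : ℝ => (u - v) (AffineMap.lineMap p x (s : ℂ)))
      ((x - p) • A (AffineMap.lineMap p x (t : ℂ)) ((u - v) (AffineMap.lineMap p x (t : ℂ)))) t := by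
    intro t ht
    refine hasDerivAt_lineMap ?_
    have := (hu _ (hSΩ (hmem t ht))).sub (hv _ (hSΩ (hmem t ht)))
    simpa using this
  have key := eq_zero_of_abs_deriv_le_mul_abs_self_of_eq_zero_right (K := ‖x - p‖ * M)
    (f := fun s : ℝ => (u - v) (AffineMap.lineMap p x (s : ℂ))) (a := 0) (b := 1)
    (fun t ht => (hder t ht).continuousAt.continuousWithinAt)
    (fun t ht => (hder t ⟨ht.1, ht.2.le⟩).hasDerivWithinAt) (by simp [h0]) ?_ 1
    (Set.right_mem_Icc.2 zero_le_one)
  · simpa [sub_eq_zero] using key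
  · intro t ht
    rw [norm_smul, mul_assoc]
    gcongr
    exact ((A _).le_opNorm _).trans (by gcongr; exact hAM _ (hmem t ⟨ht.1, ht.2.le⟩))

end LinearODE

section SecondOrder

variable {Ω : Set ℂ} {p q : ℂ → ℂ} {x₀ : ℂ}

/-- The matrix of the first order system for `(y, y')` equivalent to `y'' = p y' + q y`. -/
noncomputable def companion (p q : ℂ → ℂ) (x : ℂ) : ℂ × ℂ →L[ℂ] ℂ × ℂ :=
  (ContinuousLinearMap.inl ℂ ℂ ℂ).comp (ContinuousLinearMap.snd ℂ ℂ ℂ) +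
    (p x • (ContinuousLinearMap.inr ℂ ℂ ℂ).comp (ContinuousLinearMap.snd ℂ ℂ ℂ) +
      q x • (ContinuousLinearMap.inr ℂ ℂ ℂ).comp (ContinuousLinearMap.fst ℂ ℂ ℂ))

lemma companion_apply (x : ℂ) (v : ℂ × ℂ) :
    companion p q x v = (v.2, p x * v.2 + q x * v.1) := by
  simp [companion]

lemma differentiableOn_companion (hp : DifferentiableOn ℂ p Ω) (hq : DifferentiableOn ℂ q Ω) :
    DifferentiableOn ℂ (companion p q) Ω :=
  (differentiableOn_const _).add
    ((hp.smul (differentiableOn_const _)).add (hq.smul (differentiableOn_const _)))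

theorem exists_second_order_solution (hΩ : Convex ℝ Ω) (ho : IsOpen Ω)
    (hp : DifferentiableOn ℂ p Ω) (hq : DifferentiableOn ℂ q Ω) (hx₀ : x₀ ∈ Ω) (v₀ v₁ : ℂ) :
    ∃ y y' : ℂ → ℂ, y x₀ = v₀ ∧ y' x₀ = v₁ ∧ (∀ x ∈ Ω, HasDerivAt y (y' x) x) ∧
      ∀ x ∈ Ω, HasDerivAt y' (p x * y' x + q x * y x) x := by
  obtain ⟨u, hu0, hu⟩ := exists_linear_system_solution hΩ ho (differentiableOn_companion hp hq)
    hx₀ (v₀, v₁)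
  refine ⟨fun x => (u x).1, fun x => (u x).2, by simp [hu0], by simp [hu0], fun x hx => ?_,
    fun x hx => ?_⟩
  · have := (hu x hx).fst
    rwa [companion_apply] at this
  · have := (hu x hx).snd
    rwa [companion_apply] at this

theorem second_order_solution_unique (hΩ : Convex ℝ Ω) (ho : IsOpen Ω)
    (hp : DifferentiableOn ℂ p Ω) (hq : DifferentiableOn ℂ q Ω) (hx₀ : x₀ ∈ Ω)
    {y y' w w' : ℂ → ℂ} (hy : ∀ x ∈ Ω, HasDerivAt y (y' x) x)
    (hy' : ∀ x ∈ Ω, HasDerivAt y' (p x * y' x + q x * y x) x)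
    (hw : ∀ x ∈ Ω, HasDerivAt w (w' x) x)
    (hw' : ∀ x ∈ Ω, HasDerivAt w' (p x * w' x + q x * w x) x)
    (h0 : y x₀ = w x₀) (h1 : y' x₀ = w' x₀) : Set.EqOn y w Ω := by
  have h := linear_system_solution_unique hΩ ho (differentiableOn_companion hp hq).continuousOn hx₀
    (u := fun x => (y x, y' x)) (v := fun x => (w x, w' x))
    (fun x hx => by rw [companion_apply]; exact (hy x hx).prodMk (hy' x hx))
    (fun x hx => by rw [companion_apply]; exact (hw x hx).prodMk (hw' x hx)) (by simp [h0, h1])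
  exact fun x hx => congrArg Prod.fst (h hx)

end SecondOrder

/-! ### The hypergeometric series and its differential equation -/

/-- The left-hand side of the Gauss equation with parameters `a`, `b`, `c`. -/
noncomputable def gaussOp (a b c : ℂ) (f : ℂ → ℂ) (w : ℂ) : ℂ :=
  w * (1 - w) * deriv (deriv f) w + (c - (a + b + 1) * w) * deriv f w - a * b * f w

lemma gaussOp_congr {a b c w : ℂ} {f g : ℂ → ℂ} (h : f =ᶠ[𝓝 w] g) :
    gaussOp a b c f w = gaussOp a b c g w := by
  simp only [gaussOp, h.eq_of_nhds, h.deriv.eq_of_nhds, h.deriv.deriv.eq_of_nhds]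

lemma differentiableOn_gaussOp (a b c : ℂ) {f : ℂ → ℂ} {Ω : Set ℂ} (ho : IsOpen Ω)
    (hf : DifferentiableOn ℂ f Ω) : DifferentiableOn ℂ (gaussOp a b c f) Ω := by
  have h1 := hf.deriv ho
  have h2 := h1.deriv ho
  unfold gaussOp
  fun_prop

/-- Identity theorem for holomorphic functions. -/
lemma differentiableOn_eqOn_of_eventuallyEq {f g : ℂ → ℂ} {Ω : Set ℂ} (ho : IsOpen Ω)
    (hc : IsPreconnected Ω) (hf : DifferentiableOn ℂ f Ω) (hg : DifferentiableOn ℂ g Ω) {z : ℂ}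
    (hz : z ∈ Ω) (h : f =ᶠ[𝓝 z] g) : Set.EqOn f g Ω :=
  (hf.analyticOnNhd ho).eqOn_of_preconnected_of_eventuallyEq (hg.analyticOnNhd ho) hc hz h

section Series

variable {v : ℕ → ℂ} {C R : ℝ}

lemma norm_mul_pow_le_geometric (hR : 0 < R) (hv : ∀ n, ‖v n‖ ≤ C * R ^ n) {w : ℂ}
    (hw : w ∈ Metric.ball (0 : ℂ) (1 / (2 * R))) (n : ℕ) : ‖v n * w ^ n‖ ≤ C * (1 / 2) ^ n := by
  have hw' : ‖w‖ ≤ 1 / (2 * R) := by simpa using (mem_ball_zero_iff.1 hw).le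
  have hC : 0 ≤ C := by simpa using (norm_nonneg _).trans (hv 0)
  calc ‖v n * w ^ n‖ = ‖v n‖ * ‖w‖ ^ n := by rw [norm_mul, norm_pow]
    _ ≤ C * R ^ n * (1 / (2 * R)) ^ n := by
        gcongr
        exact hv n
    _ = C * (1 / 2) ^ n := by
        rw [mul_assoc, ← mul_pow]; congr 2; field_simp

lemma hasSum_mul_pow (hR : 0 < R) (hv : ∀ n, ‖v n‖ ≤ C * R ^ n) {w : ℂ}
    (hw : w ∈ Metric.ball (0 : ℂ) (1 / (2 * R))) :
    HasSum (fun n => v n * w ^ n) (∑' n, v n * w ^ n) :=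
  (Summable.of_norm_bounded (summable_geometric_two.mul_left C)
    (norm_mul_pow_le_geometric hR hv hw)).hasSum

lemma hasSum_nat_mul_pow (hR : 0 < R) (hv : ∀ n, ‖v n‖ ≤ C * R ^ n) {w : ℂ}
    (hw : w ∈ Metric.ball (0 : ℂ) (1 / (2 * R))) :
    HasSum (fun n => n * v n * w ^ n) (w * deriv (fun w => ∑' n, v n * w ^ n) w) := by
  have h := hasSum_deriv_of_summable_norm (F := fun n w => v n * w ^ n)
    (summable_geometric_two.mul_left C) (fun n => by fun_prop) Metric.isOpen_ball
    (fun n w hw => norm_mul_pow_le_geometric hR hv hw n) hw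
  convert! h.mul_left w using 2 with n
  rcases n with _ | n
  · simp
  · have h' := ((hasDerivAt_pow (n + 1) w).const_mul (v (n + 1))).deriv
    rw [h', Nat.add_sub_cancel, pow_succ]
    ring

lemma norm_nat_mul_le (hv : ∀ n, ‖v n‖ ≤ C * R ^ n) (n : ℕ) :
    ‖n * v n‖ ≤ C * (2 * R) ^ n := by
  have h2 : (n : ℝ) ≤ 2 ^ n := by exact_mod_cast Nat.lt_two_pow_self.le
  have hC : 0 ≤ C := by simpa using (norm_nonneg _).trans (hv 0)
  rw [norm_mul, mul_pow, Complex.norm_natCast]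
  calc (n : ℝ) * ‖v n‖ ≤ 2 ^ n * (C * R ^ n) := by gcongr; exact hv n
    _ = _ := by ring

end Series

section Hypergeometric

variable {a b c : ℂ}

/-- The recursion for the coefficients, which is equivalent to the Gauss equation. -/
lemma coeff_succ (hc : ∀ n : ℕ, c + n ≠ 0) (n : ℕ) :
    (n + 1) * (c + n) * ordinaryHypergeometricCoefficient a b c (n + 1) =
      (a + n) * (b + n) * ordinaryHypergeometricCoefficient a b c n := by
  have h1 : (n.factorial : ℂ) ≠ 0 := by exact_mod_cast n.factorial_ne_zero
  have h2 : (n + 1 : ℂ) ≠ 0 := by exact_mod_cast n.succ_ne_zero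
  simp only [ordinaryHypergeometricCoefficient, ascPochhammer_succ_eval, Nat.factorial_succ,
    Nat.cast_mul, Nat.cast_add, Nat.cast_one, mul_inv]
  field_simp [hc n]

lemma one_le_radius (hc : ∀ n : ℕ, c + n ≠ 0) :
    1 ≤ (ordinaryHypergeometricSeries ℂ a b c).radius := by
  by_cases ha : ∃ n : ℕ, a = -n
  · obtain ⟨n, rfl⟩ := ha
    rw [ordinaryHypergeometric_radius_top_of_neg_nat₁]; exact le_top
  by_cases hb : ∃ n : ℕ, b = -n
  · obtain ⟨n, rfl⟩ := hb
    rw [ordinaryHypergeometric_radius_top_of_neg_nat₂]; exact le_top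
  rw [ordinaryHypergeometricSeries_radius_eq_one]
  intro n
  push Not at ha hb
  refine ⟨fun h => ha n ?_, fun h => hb n ?_, fun h => hc n ?_⟩ <;> simp [h]

lemma differentiableOn_ordinaryHypergeometric (hc : ∀ n : ℕ, c + n ≠ 0) :
    DifferentiableOn ℂ (ordinaryHypergeometric a b c : ℂ → ℂ) (Metric.ball 0 1) := by
  have h := (ordinaryHypergeometricSeries ℂ a b c).hasFPowerSeriesOnBall
    (zero_lt_one.trans_le (one_le_radius hc))
  have h2 := (h.mono zero_lt_one (one_le_radius hc)).differentiableOn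
  rwa [← ENNReal.ofReal_one, Metric.eball_ofReal] at h2

lemma exists_norm_coeff_le (hc : ∀ n : ℕ, c + n ≠ 0) :
    ∃ C : ℝ, ∀ n, ‖ordinaryHypergeometricCoefficient a b c n‖ ≤ C * 2 ^ n := by
  have h : (((1 / 2 : NNReal)) : ENNReal) < (ordinaryHypergeometricSeries ℂ a b c).radius := by
    refine lt_of_lt_of_le ?_ (one_le_radius hc)
    norm_num
  obtain ⟨C, hC, hn⟩ := (ordinaryHypergeometricSeries ℂ a b c).norm_mul_pow_le_of_lt_radius h
  refine ⟨C, fun n => ?_⟩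
  have := hn n
  rw [ordinaryHypergeometricSeries, FormalMultilinearSeries.ofScalars_norm] at this
  have h2 : (((1 / 2 : NNReal)) : ℝ) = 2⁻¹ := by simp
  rw [h2, inv_pow] at this
  rwa [← div_eq_mul_inv, div_le_iff₀ (by positivity)] at this

lemma ordinaryHypergeometric_eq_tsum_coeff (a b c : ℂ) :
    (ordinaryHypergeometric a b c : ℂ → ℂ) =
      fun w => ∑' n, ordinaryHypergeometricCoefficient a b c n * w ^ n := by
  rw [ordinaryHypergeometric_eq_tsum]; rfl

lemma gaussOp_ordinaryHypergeometric (hc : ∀ n : ℕ, c + n ≠ 0) {w : ℂ}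
    (hw : w ∈ Metric.ball (0 : ℂ) 1) : gaussOp a b c (ordinaryHypergeometric a b c) w = 0 := by
  set F : ℂ → ℂ := ordinaryHypergeometric a b c with hF
  have hdF : DifferentiableOn ℂ F (Metric.ball 0 1) := differentiableOn_ordinaryHypergeometric hc
  obtain ⟨C, hC⟩ := exists_norm_coeff_le (a := a) (b := b) hc
  set v := ordinaryHypergeometricCoefficient a b c with hv
  have hFs : F = fun w => ∑' n, v n * w ^ n := ordinaryHypergeometric_eq_tsum_coeff a b c
  have hC' := norm_nat_mul_le hC
  -- The equation near the origin, from the recursion for the coefficients.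
  have near : ∀ w ∈ Metric.ball (0 : ℂ) (1 / 8), w ≠ 0 → gaussOp a b c F w = 0 := by
    intro w hw hw0
    have hw1 : w ∈ Metric.ball (0 : ℂ) (1 / (2 * (2 * 2))) := by norm_num at hw ⊢; exact hw
    have hw2 : w ∈ Metric.ball (0 : ℂ) (1 / (2 * 2)) :=
      Metric.ball_subset_ball (by norm_num) hw
    have hw3 : w ∈ Metric.ball (0 : ℂ) 1 := Metric.ball_subset_ball (by norm_num) hw
    have s0 : HasSum (fun n => v n * w ^ n) (F w) := by
      rw [hFs]; exact hasSum_mul_pow two_pos hC hw2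
    have s1 : HasSum (fun n => n * v n * w ^ n) (w * deriv F w) := by
      rw [hFs]; exact hasSum_nat_mul_pow two_pos hC hw2
    have s2 := hasSum_nat_mul_pow (by norm_num) hC' hw1
    have e : (fun w => ∑' n : ℕ, n * v n * w ^ n) =ᶠ[𝓝 w] fun w => w * deriv F w := by
      filter_upwards [Metric.isOpen_ball.mem_nhds hw2] with x hx
      rw [hFs]
      exact (hasSum_nat_mul_pow two_pos hC hx).tsum_eq
    have hd2 : DifferentiableAt ℂ (deriv F) w :=
      (hdF.deriv Metric.isOpen_ball).differentiableAt (Metric.isOpen_ball.mem_nhds hw3)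
    rw [e.deriv_eq, ((hasDerivAt_id' w).fun_mul hd2.hasDerivAt).deriv, one_mul] at s2
    have t1 := s2.add (s1.mul_left (c - 1))
    have t2 := ((s2.add (s1.mul_left (a + b))).add (s0.mul_left (a * b))).mul_left w
    have t1' := (hasSum_nat_add_iff' 1).2 t1
    simp only [Finset.sum_range_one, Nat.cast_zero, zero_mul, mul_zero, add_zero,
      sub_zero] at t1'
    have heq := t1'.unique (t2.congr_fun fun n => ?_)
    · have : w * gaussOp a b c F w = 0 := by
        rw [gaussOp]; linear_combination heq
      exact (mul_eq_zero.1 this).resolve_left hw0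
    · have := coeff_succ (a := a) (b := b) hc n
      rw [← hv] at this
      push_cast
      rw [pow_succ]
      linear_combination (w ^ n * w) * this
  have h0 : (0 : ℂ) ∈ Metric.ball (0 : ℂ) 1 := Metric.mem_ball_self one_pos
  refine ((differentiableOn_gaussOp a b c Metric.isOpen_ball hdF).analyticOnNhd
    Metric.isOpen_ball).eqOn_zero_of_preconnected_of_frequently_eq_zero
    (convex_ball _ _).isPreconnected h0 ?_ hw
  refine Eventually.frequently ?_
  filter_upwards [self_mem_nhdsWithin, nhdsWithin_le_nhds
    (Metric.isOpen_ball.mem_nhds (Metric.mem_ball_self (by norm_num : (0 : ℝ) < 1 / 8)))]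
    with x hx hx'
  exact near x hx' hx

end Hypergeometric

/-! ### Continuation of the hypergeometric function to the cut plane -/

/-- `ℂ` without the half-line `[1, ∞)`. -/
def cutPlane : Set ℂ := {w | 1 - w ∈ slitPlane}

lemma isOpen_cutPlane : IsOpen cutPlane :=
  isOpen_slitPlane.preimage (by fun_prop : Continuous fun w : ℂ => 1 - w)

lemma isPreconnected_slitPlane : IsPreconnected slitPlane :=
  (starConvex_one_slitPlane.isPathConnected one_mem_slitPlane).isConnected.isPreconnected

lemma inv_mem_slitPlane {z : ℂ} (hz : z ∈ slitPlane) : z⁻¹ ∈ slitPlane := by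
  have h0 := normSq_pos.2 (slitPlane_ne_zero hz)
  rw [mem_slitPlane_iff, inv_re, inv_im]
  rcases mem_slitPlane_iff.1 hz with h | h
  · exact Or.inl (by positivity)
  · exact Or.inr (div_ne_zero (neg_ne_zero.2 h) h0.ne')

lemma isPreconnected_cutPlane : IsPreconnected cutPlane := by
  have h : cutPlane = (fun w : ℂ => 1 - w) '' slitPlane := by
    ext w
    exact ⟨fun hw => ⟨1 - w, hw, by ring⟩, by rintro ⟨v, hv, rfl⟩; simpa [cutPlane] using hv⟩
  rw [h]
  exact isPreconnected_slitPlane.image _ (by fun_prop)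

lemma zero_mem_cutPlane : (0 : ℂ) ∈ cutPlane := by simp [cutPlane]

lemma ball_subset_cutPlane : Metric.ball (0 : ℂ) 1 ⊆ cutPlane := by
  intro w hw
  rw [mem_ball_zero_iff] at hw
  have := mem_slitPlane_of_norm_lt_one (z := -w) (by rwa [norm_neg])
  simpa [cutPlane, sub_eq_add_neg] using this

lemma neg_mem_slitPlane_of_mem_cutPlane {w : ℂ} (hw : w ∈ cutPlane) (h : 1 ≤ ‖w‖) :
    -w ∈ slitPlane := by
  rw [mem_slitPlane_iff]
  by_contra! hcon
  obtain ⟨h1, h2⟩ := hcon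
  have him : w.im = 0 := by simpa using h2
  have hre : 0 ≤ w.re := by simpa using h1
  have hw' : w = (w.re : ℂ) := Complex.ext (by simp) (by simp [him])
  have h1' : 1 ≤ w.re := by
    rwa [hw', Complex.norm_real, Real.norm_of_nonneg hre] at h
  rcases mem_slitPlane_iff.1 hw with h3 | h3
  · simp at h3; linarith
  · simp [him] at h3

lemma one_add_exp_ne_zero {u : ℂ} (h1 : -Real.pi < u.im) (h2 : u.im < Real.pi) :
    1 + exp u ≠ 0 := by
  intro h
  have h3 : exp u = -1 := by linear_combination h
  have h4 := log_exp h1 h2.le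
  rw [h3, log_neg_one] at h4
  rw [← h4] at h2
  simp at h2

variable {a b c : ℂ}

/-- In the coordinate `u` with `w = -exp u` the plane cut along `[0, ∞)` becomes a strip, which is
convex, and the Gauss equation becomes a linear equation without singular points there. -/
theorem exists_continuation_ordinaryHypergeometric (hc : ∀ n : ℕ, c + n ≠ 0) :
    ∃ H : ℂ → ℂ, DifferentiableOn ℂ H cutPlane ∧
      Set.EqOn H (ordinaryHypergeometric a b c) (Metric.ball 0 1) := by
  set F : ℂ → ℂ := ordinaryHypergeometric a b c with hF
  have hdF : DifferentiableOn ℂ F (Metric.ball 0 1) := differentiableOn_ordinaryHypergeometric hc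
  set S : Set ℂ := Complex.im ⁻¹' Set.Ioo (-Real.pi) Real.pi with hS
  set L : Set ℂ := S ∩ Complex.re ⁻¹' Set.Iio 0 with hL
  have hSo : IsOpen S := isOpen_Ioo.preimage continuous_im
  have hLo : IsOpen L := hSo.inter (isOpen_Iio.preimage continuous_re)
  have hSc : Convex ℝ S := (convex_Ioo _ _).linear_preimage Complex.imLm
  have hLc : Convex ℝ L := hSc.inter ((convex_Iio _).linear_preimage Complex.reLm)
  have hne : ∀ u ∈ S, 1 + exp u ≠ 0 := fun u hu => one_add_exp_ne_zero hu.1 hu.2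
  set p : ℂ → ℂ := fun u => (-(a + b) * exp u - (c - 1)) / (1 + exp u) with hp
  set q : ℂ → ℂ := fun u => -(a * b * exp u) / (1 + exp u) with hq
  have hpd : DifferentiableOn ℂ p S := by
    rw [hp]; exact DifferentiableOn.div (by fun_prop) (by fun_prop) hne
  have hqd : DifferentiableOn ℂ q S := by
    rw [hq]; exact DifferentiableOn.div (by fun_prop) (by fun_prop) hne
  have hm1 : (-1 : ℂ) ∈ L := by
    refine ⟨⟨?_, ?_⟩, ?_⟩ <;> simp [Real.pi_pos]
  obtain ⟨Y, Y', h0, h1, hY, hY'⟩ := exists_second_order_solution hSc hSo hpd hqd hm1.1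
    (F (-exp (-1))) (-exp (-1) * deriv F (-exp (-1)))
  have hball : ∀ u ∈ L, -exp u ∈ Metric.ball (0 : ℂ) 1 := by
    intro u hu
    rw [mem_ball_zero_iff, norm_neg, norm_exp]
    rw [← Real.exp_zero]; exact Real.exp_lt_exp.2 hu.2
  have hnegexp : ∀ u : ℂ, HasDerivAt (fun u : ℂ => -exp u) (-exp u) u :=
    fun u => (Complex.hasDerivAt_exp u).neg
  have hEq : Set.EqOn Y (fun u => F (-exp u)) L := by
    refine second_order_solution_unique hLc hLo (hpd.mono Set.inter_subset_left)
      (hqd.mono Set.inter_subset_left) hm1 (fun x hx => hY x hx.1) (fun x hx => hY' x hx.1)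
      (w' := fun u => -exp u * deriv F (-exp u)) ?_ ?_ h0 h1
    · intro u hu
      have := (hdF.differentiableAt (Metric.isOpen_ball.mem_nhds (hball u hu))).hasDerivAt.comp u
        (hnegexp u)
      rwa [mul_comm] at this
    · intro u hu
      have hd := ((hdF.deriv Metric.isOpen_ball).differentiableAt
        (Metric.isOpen_ball.mem_nhds (hball u hu))).hasDerivAt.comp u (hnegexp u)
      have := (hnegexp u).fun_mul hd
      refine this.congr_deriv ?_
      have hode := gaussOp_ordinaryHypergeometric (a := a) (b := b) hc (hball u hu)
      rw [← hF, gaussOp] at hode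
      have hne' := hne u hu.1
      simp only [hp, hq, Function.comp_apply]
      field_simp
      linear_combination -hode
  -- The series in the unit disc and the solution on the strip agree where both are defined.
  refine ⟨fun w => if ‖w‖ < 1 then F w else Y (log (-w)), ?_, ?_⟩
  · intro w hw
    refine DifferentiableAt.differentiableWithinAt ?_
    by_cases hw1 : ‖w‖ < 1
    · refine (hdF.differentiableAt (Metric.isOpen_ball.mem_nhds
        (mem_ball_zero_iff.2 hw1))).congr_of_eventuallyEq ?_
      filter_upwards [Metric.isOpen_ball.mem_nhds (mem_ball_zero_iff.2 hw1)] with x hx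
      rw [if_pos (mem_ball_zero_iff.1 hx)]
    · have hs := neg_mem_slitPlane_of_mem_cutPlane hw (not_lt.1 hw1)
      have hlog : ∀ x : ℂ, -x ∈ slitPlane → log (-x) ∈ S := fun x hx =>
        ⟨by rw [log_im]; exact neg_pi_lt_arg _,
          by rw [log_im]; exact lt_of_le_of_ne (arg_le_pi _) (mem_slitPlane_iff_arg.1 hx).1⟩
      have hd : DifferentiableAt ℂ (fun w => Y (log (-w))) w :=
        DifferentiableAt.comp w (hY _ (hlog w hs)).differentiableAt
          ((differentiableAt_id.neg).clog hs)
      refine hd.congr_of_eventuallyEq ?_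
      filter_upwards [(isOpen_slitPlane.preimage continuous_neg).mem_nhds hs] with x hx
      split_ifs with hx1
      · have hx0 : -x ≠ 0 := slitPlane_ne_zero hx
        have hmem : log (-x) ∈ L := ⟨hlog x hx, by
          simp only [Set.mem_preimage, Set.mem_Iio, log_re, norm_neg]
          exact Real.log_neg (norm_pos_iff.2 (by simpa using hx0)) hx1⟩
        rw [hEq hmem]
        simp only [exp_log hx0, neg_neg]
      · rfl
  · intro w hw
    simp only
    rw [if_pos (mem_ball_zero_iff.1 hw)]

/-- The hypergeometric function, continued analytically to the plane cut along `[1, ∞)`. -/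
noncomputable def hyp (a b c : ℂ) : ℂ → ℂ :=
  continuation (Metric.ball 0 1) cutPlane (ordinaryHypergeometric a b c)

lemma continuation_spec {U V : Set ℂ} {f : ℂ → ℂ}
    (h : ∃ g : ℂ → ℂ, DifferentiableOn ℂ g V ∧ Set.EqOn g f U) :
    DifferentiableOn ℂ (continuation U V f) V ∧ Set.EqOn (continuation U V f) f U := by
  rw [continuation, dif_pos h]
  exact h.choose_spec

lemma differentiableOn_hyp (hc : ∀ n : ℕ, c + n ≠ 0) :
    DifferentiableOn ℂ (hyp a b c) cutPlane :=
  (continuation_spec (exists_continuation_ordinaryHypergeometric hc)).1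

lemma hyp_eqOn_ball (hc : ∀ n : ℕ, c + n ≠ 0) :
    Set.EqOn (hyp a b c) (ordinaryHypergeometric a b c) (Metric.ball 0 1) :=
  (continuation_spec (exists_continuation_ordinaryHypergeometric hc)).2

lemma hyp_zero (hc : ∀ n : ℕ, c + n ≠ 0) : hyp a b c 0 = 1 := by
  rw [hyp_eqOn_ball hc (Metric.mem_ball_self one_pos), ordinaryHypergeometric_zero]

lemma hyp_symm (a b c : ℂ) : hyp a b c = hyp b a c := by
  have : (ordinaryHypergeometric a b c : ℂ → ℂ) = ordinaryHypergeometric b a c := by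
    ext x; simp only [ordinaryHypergeometric, ordinaryHypergeometricSeries_symm a b c]
  rw [hyp, hyp, this]

lemma gaussOp_hyp (hc : ∀ n : ℕ, c + n ≠ 0) {w : ℂ} (hw : w ∈ cutPlane) :
    gaussOp a b c (hyp a b c) w = 0 := by
  have h0 : (0 : ℂ) ∈ Metric.ball (0 : ℂ) 1 := Metric.mem_ball_self one_pos
  refine differentiableOn_eqOn_of_eventuallyEq (g := fun _ => 0) isOpen_cutPlane
    isPreconnected_cutPlane (differentiableOn_gaussOp a b c isOpen_cutPlane
    (differentiableOn_hyp hc)) (differentiableOn_const _) zero_mem_cutPlane ?_ hw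
  filter_upwards [Metric.isOpen_ball.mem_nhds h0] with x hx
  rw [gaussOp_congr (Filter.eventuallyEq_of_mem (Metric.isOpen_ball.mem_nhds hx)
    (hyp_eqOn_ball hc)), gaussOp_ordinaryHypergeometric hc hx]

/-! ### Euler's and Pfaff's transformations -/

/-- At the singular point `0` the only exponent that is a natural number is `0`, because the other
one is `1 - c`: a solution that is analytic and vanishes at `0` is zero. -/
lemma eventually_eq_zero_of_gaussOp (hc : ∀ n : ℕ, c + n ≠ 0) {f : ℂ → ℂ} (hf : AnalyticAt ℂ f 0)
    (h0 : f 0 = 0) (hode : ∀ᶠ w in 𝓝 0, gaussOp a b c f w = 0) : ∀ᶠ w in 𝓝 0, f w = 0 := by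
  by_contra hcon
  obtain ⟨n, g, hg, hg0, hfg⟩ := hf.exists_eventuallyEq_pow_smul_nonzero_iff.2 hcon
  simp only [sub_zero, smul_eq_mul] at hfg
  obtain _ | n := n
  · have := hfg.self_of_nhds
    rw [h0] at this
    simp at this
    exact hg0 this.symm
  -- With `f = w ^ (n + 1) g` the equation, divided by `w ^ n`, reads `k = 0`.
  set k : ℂ → ℂ := fun w => (1 - w) * ((n + 1) * n * g w + 2 * (n + 1) * w * deriv g w +
    w ^ 2 * deriv (deriv g) w) + (c - (a + b + 1) * w) * ((n + 1) * g w + w * deriv g w) -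
    a * b * w * g w with hk
  have key : ∀ᶠ w in 𝓝 (0 : ℂ), w ^ n * k w = 0 := by
    have hga : ∀ᶠ w in 𝓝 0, AnalyticAt ℂ g w := hg.eventually_analyticAt
    filter_upwards [hode, hfg.eventually_nhds, hga] with w hw hfw hgw
    have hpow : ∀ m : ℕ, HasDerivAt (fun w : ℂ => w ^ (m + 1)) ((m + 1) * w ^ m) w := by
      intro m; simpa using hasDerivAt_pow (m + 1) w
    have hd1 : ∀ x, AnalyticAt ℂ g x → HasDerivAt (fun w : ℂ => w ^ (n + 1) * g w)
        ((n + 1) * x ^ n * g x + x ^ (n + 1) * deriv g x) x := by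
      intro x hx
      have hpow : HasDerivAt (fun w : ℂ => w ^ (n + 1)) ((n + 1) * x ^ n) x := by
        simpa using hasDerivAt_pow (n + 1) x
      exact hpow.fun_mul hx.differentiableAt.hasDerivAt
    have e1 : deriv (fun w : ℂ => w ^ (n + 1) * g w) =ᶠ[𝓝 w]
        fun x => (n + 1) * x ^ n * g x + x ^ (n + 1) * deriv g x := by
      filter_upwards [hgw.eventually_analyticAt] with x hx using (hd1 x hx).deriv
    have hd2 : w * deriv (fun x => (n + 1) * x ^ n * g x + x ^ (n + 1) * deriv g x) w =
        w ^ n * ((n + 1) * n * g w + 2 * (n + 1) * w * deriv g w + w ^ 2 * deriv (deriv g) w) := by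
      have h1 := (((hasDerivAt_pow n w).const_mul ((n : ℂ) + 1)).fun_mul
        hgw.differentiableAt.hasDerivAt).fun_add
        ((hpow n).fun_mul hgw.deriv.differentiableAt.hasDerivAt)
      rw [h1.deriv]
      rcases n with _ | n
      · simp; ring
      · push_cast
        ring
    rw [gaussOp_congr hfw, gaussOp, e1.deriv_eq, e1.eq_of_nhds] at hw
    rw [hk]
    linear_combination hw - (1 - w) * hd2
  have hkc : ContinuousAt k 0 := by
    have h1 := hg.continuousAt
    have h2 := hg.deriv.continuousAt
    have h3 := hg.deriv.deriv.continuousAt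
    rw [hk]; fun_prop
  have hk0 : k 0 = 0 := by
    have h1 : Tendsto k (𝓝[≠] 0) (𝓝 (k 0)) := hkc.tendsto.mono_left nhdsWithin_le_nhds
    refine tendsto_nhds_unique (h1.congr' ?_) tendsto_const_nhds
    filter_upwards [self_mem_nhdsWithin, key.filter_mono nhdsWithin_le_nhds] with w hw hw'
    exact (mul_eq_zero.1 hw').resolve_left (pow_ne_zero _ hw)
  have : (n + 1) * (c + n) * g 0 = 0 := by
    rw [hk] at hk0; simp at hk0
    linear_combination hk0
  have hn : (n + 1 : ℂ) ≠ 0 := by exact_mod_cast n.succ_ne_zero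
  exact (mul_ne_zero (mul_ne_zero hn (hc n)) hg0) this

/-- The hypergeometric function is the solution of the Gauss equation that is analytic at `0` and
takes the value `1` there. -/
lemma eqOn_hyp_of_gaussOp (hc : ∀ n : ℕ, c + n ≠ 0) {f : ℂ → ℂ} (hf : DifferentiableOn ℂ f cutPlane)
    (h0 : f 0 = 1) (hode : ∀ w ∈ cutPlane, gaussOp a b c f w = 0) :
    Set.EqOn f (hyp a b c) cutPlane := by
  have hn := isOpen_cutPlane.mem_nhds zero_mem_cutPlane
  have hh := differentiableOn_hyp (a := a) (b := b) hc
  have hd : DifferentiableOn ℂ (fun w => f w - hyp a b c w) cutPlane := hf.sub hh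
  refine differentiableOn_eqOn_of_eventuallyEq isOpen_cutPlane isPreconnected_cutPlane hf hh
    zero_mem_cutPlane ?_
  have := eventually_eq_zero_of_gaussOp (a := a) (b := b) hc
    (hd.analyticAt hn) (by simp [h0, hyp_zero hc]) ?_
  · filter_upwards [this] with w hw using sub_eq_zero.1 hw
  filter_upwards [hn] with w hw
  have hnw := isOpen_cutPlane.mem_nhds hw
  have e1 : deriv (fun w => f w - hyp a b c w) =ᶠ[𝓝 w] fun w => deriv f w - deriv (hyp a b c) w := by
    filter_upwards [hnw] with x hx
    have hnx := isOpen_cutPlane.mem_nhds hx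
    exact deriv_fun_sub (hf.differentiableAt hnx) (hh.differentiableAt hnx)
  have e2 := deriv_fun_sub ((hf.deriv isOpen_cutPlane).differentiableAt hnw)
    ((hh.deriv isOpen_cutPlane).differentiableAt hnw)
  have h1 := hode w hw
  have h2 := gaussOp_hyp (a := a) (b := b) hc hw
  rw [gaussOp] at h1 h2 ⊢
  rw [e1.deriv_eq, e1.eq_of_nhds, e2]
  linear_combination h1 - h2

lemma div_sub_one_mem_cutPlane {w : ℂ} (hw : w ∈ cutPlane) : w / (w - 1) ∈ cutPlane := by
  have hne : (1 - w) ≠ 0 := slitPlane_ne_zero hw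
  have hne' : w - 1 ≠ 0 := fun h => hne (by linear_combination -h)
  have : 1 - w / (w - 1) = (1 - w)⁻¹ := by field_simp; ring
  change 1 - w / (w - 1) ∈ slitPlane
  rw [this]
  exact inv_mem_slitPlane hw

/-- Pfaff's transformation. -/
theorem hyp_pfaff (hc : ∀ n : ℕ, c + n ≠ 0) {w : ℂ} (hw : w ∈ cutPlane) :
    hyp a b c w = (1 - w) ^ (-b) * hyp (c - a) b c (w / (w - 1)) := by
  set G := hyp (c - a) b c with hG
  have hGd : DifferentiableOn ℂ G cutPlane := differentiableOn_hyp hc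
  have hne : ∀ w ∈ cutPlane, 1 - w ≠ 0 := fun w hw => slitPlane_ne_zero hw
  have hne' : ∀ w ∈ cutPlane, w - 1 ≠ 0 := fun w hw h => hne w hw (by linear_combination -h)
  have hφ : ∀ w ∈ cutPlane, HasDerivAt (fun w : ℂ => w / (w - 1)) (-1 / (1 - w) ^ 2) w := by
    intro w hw
    have := (hasDerivAt_id' w).fun_div ((hasDerivAt_id' w).sub_const 1) (hne' w hw)
    refine this.congr_deriv ?_
    have := hne w hw
    have := hne' w hw
    rw [div_eq_div_iff (by positivity) (by positivity)]
    ring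
  have hpow : ∀ s : ℂ, ∀ w ∈ cutPlane,
      HasDerivAt (fun w : ℂ => (1 - w) ^ s) (-(s * ((1 - w) ^ s / (1 - w)))) w := by
    intro s w hw
    have := ((hasDerivAt_id' w).const_sub 1).cpow_const (c := s) hw
    refine this.congr_deriv ?_
    rw [cpow_sub _ _ (hne w hw), cpow_one]
    ring
  have hcomp : ∀ f : ℂ → ℂ, DifferentiableOn ℂ f cutPlane → ∀ w ∈ cutPlane,
      HasDerivAt (fun w => f (w / (w - 1))) (deriv f (w / (w - 1)) * (-1 / (1 - w) ^ 2)) w :=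
    fun f hf w hw => ((hf.differentiableAt (isOpen_cutPlane.mem_nhds
      (div_sub_one_mem_cutPlane hw))).hasDerivAt).comp w (hφ w hw)
  have hder : ∀ w ∈ cutPlane, HasDerivAt (fun w => (1 - w) ^ (-b) * G (w / (w - 1)))
      ((1 - w) ^ (-b) * (b / (1 - w) * G (w / (w - 1)) -
        1 / (1 - w) ^ 2 * deriv G (w / (w - 1)))) w := by
    intro w hw
    refine ((hpow (-b) w hw).fun_mul (hcomp G hGd w hw)).congr_deriv ?_
    ring
  refine (eqOn_hyp_of_gaussOp hc (f := fun w => (1 - w) ^ (-b) * G (w / (w - 1))) ?_ ?_ ?_ hw).symm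
  · exact fun w hw => (hder w hw).differentiableAt.differentiableWithinAt
  · simp [hG, hyp_zero hc]
  · intro w hw
    have e1 : deriv (fun w => (1 - w) ^ (-b) * G (w / (w - 1))) =ᶠ[𝓝 w] fun w =>
        (1 - w) ^ (-b) * (b / (1 - w) * G (w / (w - 1)) -
          1 / (1 - w) ^ 2 * deriv G (w / (w - 1))) := by
      filter_upwards [isOpen_cutPlane.mem_nhds hw] with x hx using (hder x hx).deriv
    have hn1 := hne w hw
    have hn2 := hne' w hw
    have i1 : HasDerivAt (fun w : ℂ => b / (1 - w)) (b / (1 - w) ^ 2) w := by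
      refine ((hasDerivAt_const w b).fun_div ((hasDerivAt_id' w).const_sub 1) hn1).congr_deriv ?_
      ring
    have i2 : HasDerivAt (fun w : ℂ => 1 / (1 - w) ^ 2) (2 / (1 - w) ^ 3) w := by
      refine ((hasDerivAt_const w 1).fun_div (((hasDerivAt_id' w).const_sub 1).fun_pow 2)
        (pow_ne_zero 2 hn1)).congr_deriv ?_
      field_simp
      ring
    have h2 := (hpow (-b) w hw).fun_mul ((i1.fun_mul (hcomp G hGd w hw)).fun_sub
      (i2.fun_mul (hcomp (deriv G) (hGd.deriv isOpen_cutPlane) w hw)))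
    have hode := gaussOp_hyp (a := c - a) (b := b) hc (div_sub_one_mem_cutPlane hw)
    rw [← hG, gaussOp] at hode
    rw [gaussOp, e1.deriv_eq, e1.eq_of_nhds, h2.deriv]
    generalize deriv (deriv G) (w / (w - 1)) = g2 at *
    generalize deriv G (w / (w - 1)) = g1 at *
    generalize G (w / (w - 1)) = g0 at *
    generalize (1 - w) ^ (-b) = P at *
    have h3 : w / (w - 1) = -w / (1 - w) := by field_simp; ring
    rw [h3] at hode
    field_simp at hode ⊢
    linear_combination (-P) * hode

/-- Euler's transformation. -/
theorem hyp_euler (hc : ∀ n : ℕ, c + n ≠ 0) {w : ℂ} (hw : w ∈ cutPlane) :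
    hyp a b c w = (1 - w) ^ (c - a - b) * hyp (c - a) (c - b) c w := by
  have hn1 : 1 - w ≠ 0 := slitPlane_ne_zero hw
  have hn2 : w - 1 ≠ 0 := fun h => hn1 (by linear_combination -h)
  have h1 : 1 - w / (w - 1) = (1 - w)⁻¹ := by field_simp; ring
  have h2 : w / (w - 1) / (w / (w - 1) - 1) = w := by
    have : w / (w - 1) - 1 = 1 / (w - 1) := by field_simp; ring
    rw [this]; field_simp
  rw [hyp_pfaff hc hw, hyp_symm, hyp_pfaff hc (div_sub_one_mem_cutPlane hw), h1, h2,
    hyp_symm (c - b), ← mul_assoc]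
  congr 1
  rw [inv_cpow _ _ (mem_slitPlane_iff_arg.1 hw).1, ← cpow_neg, ← cpow_add _ _ hn1]
  congr 1
  ring

/-! ### Uniform estimates for a large third parameter -/

/-- A solution of `P' = -K P + g` does not leave the disc of radius `M` if the damping `re K`
dominates `‖g‖ / M`. -/
lemma norm_le_of_damped {P K g : ℝ → ℂ} {κ : ℝ → ℝ} {t₀ t₁ M : ℝ}
    (hd : ∀ t ∈ Set.Icc t₀ t₁, HasDerivAt P (-K t * P t + g t) t)
    (hκ : ∀ t ∈ Set.Icc t₀ t₁, 0 < κ t) (hK : ∀ t ∈ Set.Icc t₀ t₁, κ t ≤ (K t).re)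
    (hg : ∀ t ∈ Set.Icc t₀ t₁, ‖g t‖ ≤ κ t * M) (h0 : ‖P t₀‖ ≤ M) :
    ∀ t ∈ Set.Icc t₀ t₁, ‖P t‖ ≤ M := by
  intro t ht
  have hM : 0 ≤ M := (norm_nonneg _).trans h0
  refine le_of_forall_gt_imp_ge_of_dense fun M₁ hM₁ => ?_
  have hM₁0 : 0 < M₁ := hM.trans_lt hM₁
  have key := image_le_of_deriv_right_lt_deriv_boundary (f := fun t => ‖P t‖ ^ 2) (a := t₀)
    (b := t₁) (B := fun _ => M₁ ^ 2) (B' := fun _ => 0)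
    (fun t ht => ((hd t ht).norm_sq).continuousAt.continuousWithinAt)
    (fun t ht => ((hd t ⟨ht.1, ht.2.le⟩).norm_sq).hasDerivWithinAt)
    (by gcongr; exact h0.trans hM₁.le) (fun _ => hasDerivAt_const _ _) ?_ ht
  · exact (pow_le_pow_iff_left₀ (norm_nonneg _) hM₁0.le two_ne_zero).1 key
  · intro t ht heq
    have ht' : t ∈ Set.Icc t₀ t₁ := ⟨ht.1, ht.2.le⟩
    have hP : ‖P t‖ = M₁ := (pow_left_inj₀ (norm_nonneg _) hM₁0.le two_ne_zero).1 heq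
    have h1 : inner ℝ (P t) (-K t * P t) = -(K t).re * ‖P t‖ ^ 2 := by
      rw [Complex.inner, ← Complex.normSq_eq_norm_sq, Complex.normSq_apply]
      simp only [neg_mul, mul_neg, neg_re, mul_re, conj_re, conj_im, mul_im]
      ring
    have h2 : inner ℝ (P t) (g t) ≤ M₁ * (κ t * M) := by
      refine (real_inner_le_norm _ _).trans ?_
      rw [hP]
      gcongr
      exact hg t ht'
    rw [inner_add_right, h1, hP]
    have h3 : κ t * M₁ ^ 2 ≤ (K t).re * M₁ ^ 2 := by gcongr; exact hK t ht'
    have h4 : 0 < κ t * M₁ * (M₁ - M) := by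
      have := hκ t ht'
      have : 0 < M₁ - M := by linarith
      positivity
    nlinarith

lemma add_nat_ne_zero_of_im_ne_zero {c : ℂ} (hc : c.im ≠ 0) (n : ℕ) : c + n ≠ 0 := by
  intro h
  apply hc
  simpa using congrArg Complex.im h

/-- The imaginary part of `c` takes over where the real part of `c + n` is small. -/
lemma half_le_norm_add_nat {c : ℂ} {C₀ : ℝ} (hre : |c.re| ≤ C₀) (him : C₀ + 1 ≤ |c.im|) (n : ℕ) :
    ((n : ℝ) + 1) / 2 ≤ ‖c + n‖ := by
  have h1 : |c.im| ≤ ‖c + n‖ := by simpa using abs_im_le_norm (c + n)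
  have h2 : c.re + n ≤ ‖c + n‖ := by simpa using re_le_norm (c + n)
  have h3 := neg_abs_le c.re
  linarith

/-- Coefficient bounds for `|im c|` large: all of them but the constant one are `O(1 / |im c|)`. -/
lemma norm_coeff_succ_le {a b c : ℂ} {C₀ : ℝ} (hre : |c.re| ≤ C₀) (him : C₀ + 1 ≤ |c.im|) (n : ℕ) :
    ‖ordinaryHypergeometricCoefficient a b c (n + 1)‖ ≤
      ‖a‖ * ‖b‖ / |c.im| * (2 * (‖a‖ + 1) * (‖b‖ + 1)) ^ n := by
  have hpos : 0 < |c.im| := by linarith [abs_nonneg c.re]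
  have hc : ∀ n : ℕ, c + n ≠ 0 := add_nat_ne_zero_of_im_ne_zero (abs_pos.1 hpos)
  have hnorm : ∀ (d : ℂ) (k : ℕ), ‖d + k‖ ≤ (‖d‖ + 1) * (k + 1) := by
    intro d k
    have h1 : ‖d + k‖ ≤ ‖d‖ + k := by simpa using norm_add_le d (k : ℂ)
    nlinarith [norm_nonneg d, (Nat.cast_nonneg k : (0 : ℝ) ≤ k)]
  induction n with
  | zero =>
    have h := coeff_succ (a := a) (b := b) hc 0
    have hc0 := hc 0
    have h1 : |c.im| ≤ ‖c‖ := abs_im_le_norm c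
    have h2 : ordinaryHypergeometricCoefficient a b c (0 + 1) = a * b / c := by
      simp [ordinaryHypergeometricCoefficient]
      ring
    rw [h2, norm_div, norm_mul, pow_zero, mul_one]
    gcongr
  | succ n ih =>
    have h := congrArg norm (coeff_succ (a := a) (b := b) hc (n + 1))
    set u := ordinaryHypergeometricCoefficient a b c (n + 1) with hu
    set u' := ordinaryHypergeometricCoefficient a b c (n + 1 + 1) with hu'
    set D := ‖a‖ * ‖b‖ / |c.im|
    clear_value u u' D
    set N : ℝ := ((n + 1 : ℕ) : ℝ) + 1 with hN
    have hNpos : 0 < N := by positivity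
    have h1 := half_le_norm_add_nat hre him (n + 1)
    have ha := hnorm a (n + 1)
    have hb := hnorm b (n + 1)
    have hN' : ‖(((n + 1 : ℕ) : ℂ) + 1)‖ = N := by
      rw [hN]; exact_mod_cast Complex.norm_natCast (n + 1 + 1)
    rw [norm_mul _ u', norm_mul _ u, norm_mul, norm_mul, hN'] at h
    have h2 : N * (N / 2) * ‖u'‖ ≤ (‖a‖ + 1) * N * ((‖b‖ + 1) * N) *
        (D * (2 * (‖a‖ + 1) * (‖b‖ + 1)) ^ n) := by
      calc N * (N / 2) * ‖u'‖ ≤ N * ‖c + (n + 1 : ℕ)‖ * ‖u'‖ := by gcongr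
        _ = ‖a + (n + 1 : ℕ)‖ * ‖b + (n + 1 : ℕ)‖ * ‖u‖ := h
        _ ≤ _ := by gcongr
    have h3 : N * (N / 2) * ‖u'‖ ≤ N * (N / 2) * (D * (2 * (‖a‖ + 1) * (‖b‖ + 1)) ^ (n + 1)) := by
      refine h2.trans_eq ?_
      rw [pow_succ]; ring
    exact le_of_mul_le_mul_left h3 (by positivity)

/-- In a fixed disc around `0` the hypergeometric function is `1 + O(1 / |im c|)`. -/
lemma exists_local_bound (a b : ℂ) (C₀ : ℝ) : ∃ ρ C : ℝ, 0 < ρ ∧ ρ ≤ 1 ∧ 0 ≤ C ∧ ∀ c w : ℂ,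
    |c.re| ≤ C₀ → C₀ + 1 ≤ |c.im| → ‖w‖ ≤ ρ → ‖hyp a b c w - 1‖ ≤ C / |c.im| ∧
      ‖deriv (hyp a b c) w‖ ≤ C / |c.im| := by
  set K : ℝ := 2 * (‖a‖ + 1) * (‖b‖ + 1) with hK
  have hK2 : 2 ≤ K := by
    have h1 := norm_nonneg a
    have h2 := norm_nonneg b
    nlinarith [mul_nonneg h1 h2]
  have hKpos : 0 < 1 / (4 * K) := by positivity
  clear_value K
  have hKi : 1 / (4 * K) ≤ 1 / 8 := one_div_le_one_div_of_le (by norm_num) (by linarith)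
  have hKi2 : 1 / (8 * K) = 1 / (4 * K) / 2 := by field_simp; norm_num
  refine ⟨1 / (8 * K), 4 * (‖a‖ * ‖b‖), by positivity, by linarith, by positivity, ?_⟩
  intro c w hre him hw
  have hpos : 0 < |c.im| := by linarith [abs_nonneg c.re]
  have hc : ∀ n : ℕ, c + n ≠ 0 := add_nat_ne_zero_of_im_ne_zero (abs_pos.1 hpos)
  set D := ‖a‖ * ‖b‖ / |c.im| with hD
  have hD0 : 0 ≤ D := by positivity
  have bound : ∀ x : ℂ, ‖x‖ ≤ 1 / (4 * K) → ‖hyp a b c x - 1‖ ≤ D / (2 * K) := by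
    intro x hx
    obtain ⟨C, hC⟩ := exists_norm_coeff_le (a := a) (b := b) hc
    have hx1 : x ∈ Metric.ball (0 : ℂ) 1 := mem_ball_zero_iff.2 (by linarith)
    have hx2 : x ∈ Metric.ball (0 : ℂ) (1 / (2 * 2)) := mem_ball_zero_iff.2 (by norm_num; linarith)
    have hs := hasSum_mul_pow two_pos hC hx2
    rw [← congrFun (ordinaryHypergeometric_eq_tsum_coeff a b c) x, ← hyp_eqOn_ball hc hx1] at hs
    have hs' := (hasSum_nat_add_iff' 1).2 hs
    have h00 : ordinaryHypergeometricCoefficient a b c 0 = 1 := by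
      simp [ordinaryHypergeometricCoefficient]
    rw [Finset.sum_range_one, h00, pow_zero, mul_one] at hs'
    rw [← hs'.tsum_eq]
    have hg : HasSum (fun n : ℕ => D / (4 * K) * (1 / 2 : ℝ) ^ n) (D / (4 * K) * 2) :=
      hasSum_geometric_two.mul_left _
    refine (tsum_of_norm_bounded hg fun n => ?_).trans_eq (by ring)
    rw [norm_mul, norm_pow]
    calc ‖ordinaryHypergeometricCoefficient a b c (n + 1)‖ * ‖x‖ ^ (n + 1)
        ≤ (D * K ^ n) * (1 / (4 * K)) ^ (n + 1) := by
          gcongr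
          exact (norm_coeff_succ_le hre him n).trans_eq (by rw [hK])
      _ = D / (4 * K) * (K * (1 / (4 * K))) ^ n := by rw [pow_succ, mul_pow]; ring
      _ ≤ D / (4 * K) * (1 / 2) ^ n := by
          have : K * (1 / (4 * K)) = 1 / 4 := by field_simp
          rw [this]
          gcongr
          norm_num
  have e : 4 * (‖a‖ * ‖b‖) / |c.im| = 4 * D := by rw [hD]; ring
  rw [e]
  constructor
  · refine (bound w (by linarith)).trans ?_
    rw [div_le_iff₀ (by positivity)]
    nlinarith
  · have hball : Metric.closedBall w (1 / (8 * K)) ⊆ cutPlane := by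
      refine Set.Subset.trans ?_ ball_subset_cutPlane
      intro x hx
      have h1 : ‖x - w‖ ≤ 1 / (8 * K) := by simpa [dist_eq_norm] using hx
      have h2 : ‖x‖ ≤ ‖x - w‖ + ‖w‖ := by simpa using norm_add_le (x - w) w
      exact mem_ball_zero_iff.2 (by linarith)
    have hd : DifferentiableOn ℂ (fun x => hyp a b c x - 1) (Metric.closedBall w (1 / (8 * K))) :=
      ((differentiableOn_hyp hc).mono hball).sub_const 1
    have h := Complex.norm_deriv_le_of_forall_mem_sphere_norm_le (C := D / (2 * K))
      (by positivity : 0 < 1 / (8 * K)) (hd.diffContOnCl_ball subset_rfl) (fun x hx => by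
        refine bound x ?_
        have h1 : ‖x - w‖ = 1 / (8 * K) := by simpa [dist_eq_norm] using hx
        have h2 : ‖x‖ ≤ ‖x - w‖ + ‖w‖ := by simpa using norm_add_le (x - w) w
        linarith)
    rw [deriv_sub_const] at h
    refine h.trans_eq ?_
    field_simp
    ring

/-- The damping rate of the Gauss equation along the ray through `w`. -/
lemma le_re_damping {a b c w : ℂ} {C₀ ρ t : ℝ} (hρ : 0 < ρ) (ht0 : 0 < t) (ht1 : t ≤ 1)
    (hD0 : 1 - (t : ℂ) * w ≠ 0) (hre : |c.re| ≤ C₀) (hsign : c.im * w.im < 0)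
    (him : ‖w‖ ≤ 2 * |w.im|) (hT : ρ ≤ t * ‖w‖)
    (hlarge : C₀ + ‖a + b + 1‖ * ‖w‖ ≤ |c.im| * (ρ / (4 * (1 + ρ)))) :
    |c.im| * (ρ / (4 * (1 + ρ))) / (t * ‖1 - (t : ℂ) * w‖) ≤
      ((c - (a + b + 1) * ((t : ℂ) * w)) / (t * (1 - (t : ℂ) * w))).re := by
  have hsw : -(c.im * w.im) = |c.im| * |w.im| := by rw [← abs_mul, abs_of_neg hsign]
  have hs0 : 0 ≤ |c.im| := abs_nonneg _
  have hnormt : ‖(t : ℂ) * w‖ = t * ‖w‖ := by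
    rw [norm_mul, Complex.norm_real, Real.norm_of_nonneg ht0.le]
  have hδle : ‖1 - (t : ℂ) * w‖ ≤ 1 + t * ‖w‖ := by
    rw [← hnormt]
    simpa using norm_sub_le (1 : ℂ) ((t : ℂ) * w)
  have hDim : (1 - (t : ℂ) * w).im = -(t * w.im) := by simp
  set s := |c.im|
  set W := ‖w‖ with hW
  have hW0 : 0 ≤ W := norm_nonneg _
  set A := ‖a + b + 1‖ with hA
  have hA0 : 0 ≤ A := norm_nonneg _
  set D : ℂ := 1 - (t : ℂ) * w with hD
  have hδ : 0 < ‖D‖ := norm_pos_iff.2 hD0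
  have hDre : |D.re| ≤ ‖D‖ := abs_re_le_norm D
  set δ := ‖D‖ with hδdef
  set m : ℝ := ρ / (4 * (1 + ρ)) with hm
  -- `re (c / D)` is bounded below because `-im c * im w = |im c| |im w|`.
  have e1 : s * (2 * m) - C₀ ≤ (c / D).re * δ := by
    have e : (c / D).re * δ = (c.re * D.re + s * (t * |w.im|)) / δ := by
      rw [Complex.div_re, Complex.normSq_eq_norm_sq, hDim, ← hδdef]
      clear_value D δ s
      field_simp
      linear_combination t * hsw
    rw [e, le_div_iff₀ hδ]
    have h3 : -(C₀ * δ) ≤ c.re * D.re := by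
      have h4 : |c.re * D.re| ≤ C₀ * δ := by
        rw [abs_mul]
        exact mul_le_mul hre hDre (abs_nonneg _) ((abs_nonneg _).trans hre)
      linarith [neg_abs_le (c.re * D.re)]
    have h5 : 2 * m * δ ≤ t * |w.im| := by
      have h6 : t * W / 2 ≤ t * |w.im| := by
        have := mul_le_mul_of_nonneg_left him ht0.le
        linarith
      refine le_trans ?_ h6
      calc 2 * m * δ ≤ 2 * m * (1 + t * W) := by gcongr
        _ = ρ * (1 + t * W) / (2 * (1 + ρ)) := by rw [hm]; field_simp; ring
        _ ≤ t * W / 2 := by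
          rw [div_le_iff₀ (by positivity)]
          linarith
    have h7 := mul_le_mul_of_nonneg_left h5 hs0
    have e2 : (s * (2 * m) - C₀) * δ = s * (2 * m * δ) - C₀ * δ := by ring
    linarith
  have e2 : ((a + b + 1) * ((t : ℂ) * w) / D).re * δ ≤ A * W := by
    have h3 : ((a + b + 1) * ((t : ℂ) * w) / D).re ≤ A * (t * W) / δ := by
      refine (re_le_norm _).trans_eq ?_
      rw [norm_div, norm_mul, hnormt]
    calc _ ≤ A * (t * W) / δ * δ := by gcongr
      _ = A * (t * W) := div_mul_cancel₀ _ hδ.ne'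
      _ ≤ A * (1 * W) := by gcongr
      _ = A * W := by ring
  have e3 : ((c - (a + b + 1) * ((t : ℂ) * w)) / (t * D)).re =
      ((c / D).re - ((a + b + 1) * ((t : ℂ) * w) / D).re) / t := by
    rw [← Complex.sub_re, ← Complex.div_ofReal_re, ← sub_div, div_div, mul_comm D]
  rw [e3, div_le_div_iff₀ (by positivity) ht0]
  have e5 : s * m ≤ ((c / D).re - ((a + b + 1) * ((t : ℂ) * w) / D).re) * δ := by
    rw [sub_mul]; linarith
  have e6 := mul_le_mul_of_nonneg_left e5 ht0.le
  linarith

/-- The estimate that carries the confluence: along the ray through `w`, on the side where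
`im c` and `im w` have opposite signs, the derivative is damped at the rate `|im c|`, so that the
hypergeometric function stays `1 + O(|w| / |im c|)`. -/
theorem exists_hyp_sub_one_bound (a b : ℂ) (C₀ : ℝ) : ∃ C S₀ : ℝ, 0 < C ∧ 0 < S₀ ∧ ∀ c w : ℂ,
    |c.re| ≤ C₀ → S₀ ≤ |c.im| → c.im * w.im < 0 → ‖w‖ ≤ 2 * |w.im| → 1 ≤ ‖w‖ →
      C * ‖w‖ ≤ |c.im| → ‖hyp a b c w - 1‖ ≤ C * ‖w‖ / |c.im| := by
  obtain ⟨ρ, C₁, hρ, hρ1, hC₁, hloc⟩ := exists_local_bound a b C₀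
  set m : ℝ := ρ / (4 * (1 + ρ)) with hm
  have hm0 : 0 < m := by positivity
  set A : ℝ := ‖a + b + 1‖ with hA
  have hA0 : 0 ≤ A := norm_nonneg _
  set B : ℝ := ‖a * b‖ with hB
  have hB0 : 0 ≤ B := norm_nonneg _
  set C : ℝ := 2 * C₁ + 4 * B / m + 2 * A / m + 1 with hC
  have hBm : 0 ≤ B / m := by positivity
  have hAm : 0 ≤ A / m := by positivity
  have hCpos : 0 < C := by
    have e1 : 4 * B / m = 4 * (B / m) := by ring
    have e2 : 2 * A / m = 2 * (A / m) := by ring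
    rw [hC, e1, e2]; positivity
  refine ⟨C, max (|C₀| + 1) (2 * |C₀| / m), hCpos,
    lt_of_lt_of_le (by positivity) (le_max_left _ _), ?_⟩
  intro c w hre hS hsign him hw1 hCw
  have hC₀ : 0 ≤ C₀ := (abs_nonneg _).trans hre
  rw [abs_of_nonneg hC₀] at hS
  have hS1 : C₀ + 1 ≤ |c.im| := (le_max_left _ _).trans hS
  have hS2 : 2 * C₀ / m ≤ |c.im| := (le_max_right _ _).trans hS
  set s := |c.im| with hs
  have hs0 : 0 < s := by linarith
  set W := ‖w‖ with hW
  have hW0 : 0 < W := by linarith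
  have hc : ∀ n : ℕ, c + n ≠ 0 := add_nat_ne_zero_of_im_ne_zero (abs_pos.1 hs0)
  set H := hyp a b c with hH
  have hHd : DifferentiableOn ℂ H cutPlane := differentiableOn_hyp hc
  set t₀ : ℝ := ρ / W with ht₀
  have ht₀0 : 0 < t₀ := by positivity
  have ht₀1 : t₀ ≤ 1 := by rw [ht₀, div_le_one hW0]; linarith
  have ht₀W : t₀ * W = ρ := by rw [ht₀]; field_simp
  have hwim : w.im ≠ 0 := fun h => by rw [h, mul_zero] at hsign; exact lt_irrefl _ hsign
  have hmem : ∀ t ∈ Set.Icc t₀ 1, (t : ℂ) * w ∈ cutPlane := by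
    intro t ht
    refine mem_slitPlane_iff.2 (Or.inr ?_)
    have : t * w.im ≠ 0 := mul_ne_zero (ht₀0.trans_le ht.1).ne' hwim
    simpa using this
  have hlin : ∀ t : ℝ, HasDerivAt (fun t : ℝ => (t : ℂ) * w) w t := by
    intro t
    simpa using (Complex.ofRealCLM.hasDerivAt (x := t)).mul_const w
  have hder : ∀ f : ℂ → ℂ, DifferentiableOn ℂ f cutPlane → ∀ t ∈ Set.Icc t₀ 1,
      HasDerivAt (fun t : ℝ => f ((t : ℂ) * w)) (w * deriv f ((t : ℂ) * w)) t := by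
    intro f hf t ht
    have h1 := (hf.differentiableAt (isOpen_cutPlane.mem_nhds (hmem t ht))).hasDerivAt
    have := h1.scomp t (hlin t)
    simpa [Function.comp_def] using this
  have hcont : ContinuousOn (fun t : ℝ => H ((t : ℂ) * w)) (Set.Icc t₀ 1) :=
    fun t ht => (hder H hHd t ht).continuousAt.continuousWithinAt
  obtain ⟨t₂, ht₂, hmax⟩ := isCompact_Icc.exists_isMaxOn (Set.nonempty_Icc.2 ht₀1) hcont.norm
  set S : ℝ := ‖H ((t₂ : ℂ) * w)‖ with hSdef
  have hSmax : ∀ t ∈ Set.Icc t₀ 1, ‖H ((t : ℂ) * w)‖ ≤ S := fun t ht => hmax ht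
  have hS0 : 0 ≤ S := norm_nonneg _
  have hnormt : ∀ t ∈ Set.Icc t₀ 1, ‖(t : ℂ) * w‖ = t * W := by
    intro t ht
    rw [norm_mul, Complex.norm_real, Real.norm_of_nonneg (ht₀0.trans_le ht.1).le]
  obtain ⟨hloc1, hloc2⟩ := hloc c ((t₀ : ℂ) * w) hre hS1
    (by rw [hnormt t₀ (Set.left_mem_Icc.2 ht₀1), ht₀W])
  set M : ℝ := (B * S / m + C₁) / s with hM
  have hM0 : 0 ≤ M := by positivity
  -- The Gauss equation along the ray, solved for the second derivative.
  have hP : ∀ t ∈ Set.Icc t₀ 1, ‖deriv H ((t : ℂ) * w)‖ ≤ M := by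
    refine norm_le_of_damped (P := fun t : ℝ => deriv H ((t : ℂ) * w))
      (K := fun t : ℝ => (c - (a + b + 1) * ((t : ℂ) * w)) / (t * (1 - (t : ℂ) * w)))
      (g := fun t : ℝ => a * b * H ((t : ℂ) * w) / (t * (1 - (t : ℂ) * w)))
      (κ := fun t : ℝ => s * m / (t * ‖1 - (t : ℂ) * w‖)) ?_ ?_ ?_ ?_ ?_
    · intro t ht
      refine (hder (deriv H) (hHd.deriv isOpen_cutPlane) t ht).congr_deriv ?_
      have h1 : (1 - (t : ℂ) * w) ≠ 0 := slitPlane_ne_zero (hmem t ht)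
      have h2 : (t : ℂ) ≠ 0 := by exact_mod_cast (ht₀0.trans_le ht.1).ne'
      have hode := gaussOp_hyp (a := a) (b := b) hc (hmem t ht)
      rw [← hH, gaussOp] at hode
      generalize deriv (deriv H) ((t : ℂ) * w) = g₂ at *
      generalize deriv H ((t : ℂ) * w) = g₁ at *
      generalize H ((t : ℂ) * w) = g₀ at *
      rw [neg_mul, div_mul_eq_mul_div, ← neg_div, ← add_div, eq_div_iff (mul_ne_zero h2 h1)]
      linear_combination hode
    · intro t ht
      have h1 : 0 < ‖1 - (t : ℂ) * w‖ := norm_pos_iff.2 (slitPlane_ne_zero (hmem t ht))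
      have h2 : 0 < t := ht₀0.trans_le ht.1
      positivity
    · intro t ht
      have h2 : 0 < t := ht₀0.trans_le ht.1
      have hT : ρ ≤ t * W := by rw [← ht₀W]; gcongr; exact ht.1
      have h3 : C₀ + A * W ≤ s * m := by
        have h3 : C₀ ≤ s * m / 2 := by
          rw [div_le_iff₀ hm0] at hS2; linarith
        have h4 : A * W ≤ s * m / 2 := by
          have h5 : 2 * A / m * W ≤ s := by
            refine le_trans ?_ hCw
            gcongr
            rw [hC]
            have : 0 ≤ 4 * B / m := by positivity
            linarith
          have h6 : 2 * A / m * W * m = 2 * A * W := by field_simp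
          have h7 := mul_le_mul_of_nonneg_right h5 hm0.le
          linarith
        linarith
      exact le_re_damping hρ h2 ht.2 (slitPlane_ne_zero (hmem t ht)) hre hsign him hT h3
    · intro t ht
      have h2 : 0 < t := ht₀0.trans_le ht.1
      have h1 : 0 < ‖1 - (t : ℂ) * w‖ := norm_pos_iff.2 (slitPlane_ne_zero (hmem t ht))
      rw [norm_div, norm_mul, norm_mul (t : ℂ), Complex.norm_real, Real.norm_of_nonneg h2.le,
        div_mul_eq_mul_div, ← hB]
      refine div_le_div_of_nonneg_right ?_ (by positivity)
      calc B * ‖H ((t : ℂ) * w)‖ ≤ B * S := by gcongr; exact hSmax t ht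
        _ ≤ B * S + C₁ * m := by linarith [mul_nonneg hC₁ hm0.le]
        _ = s * m * M := by rw [hM]; field_simp
    · refine hloc2.trans ?_
      rw [hM]
      gcongr
      have : 0 ≤ B * S / m := by positivity
      linarith
  have hfin : ∀ t ∈ Set.Icc t₀ 1, ‖H ((t : ℂ) * w) - 1‖ ≤ (2 * C₁ + B * S / m) * (W / s) := by
    intro t ht
    have h1 := norm_image_sub_le_of_norm_deriv_right_le_segment hcont
      (fun t ht => (hder H hHd t ⟨ht.1, ht.2.le⟩).hasDerivWithinAt) (C := W * M)
      (fun t ht => by rw [norm_mul]; gcongr; exact hP t ⟨ht.1, ht.2.le⟩) t ht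
    have h2 : W * M * (t - t₀) ≤ W * M * 1 := by
      gcongr
      linarith [ht.2]
    have h3 : ‖H ((t : ℂ) * w) - 1‖ ≤
        ‖H ((t : ℂ) * w) - H ((t₀ : ℂ) * w)‖ + ‖H ((t₀ : ℂ) * w) - 1‖ := by
      simpa using norm_add_le (H ((t : ℂ) * w) - H ((t₀ : ℂ) * w)) (H ((t₀ : ℂ) * w) - 1)
    have h4 : C₁ / s ≤ C₁ * (W / s) := by
      rw [← mul_div_assoc]
      gcongr
      nlinarith
    have h5 : W * M = (B * S / m + C₁) * (W / s) := by rw [hM]; ring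
    linarith
  have hWs : W / s * C ≤ 1 := by
    rw [div_mul_eq_mul_div, div_le_one hs0]; linarith
  have hWs0 : 0 ≤ W / s := by positivity
  -- The estimate bounds the maximum of the solution by itself, with a factor `1 / 2`.
  have hS4 : S ≤ 4 := by
    have h1 := hfin t₂ ht₂
    have h2 : S ≤ ‖H ((t₂ : ℂ) * w) - 1‖ + 1 := by
      simpa using norm_add_le (H ((t₂ : ℂ) * w) - 1) 1
    have e1 : B * S / m = B / m * S := by ring
    have e2 : 4 * B / m = 4 * (B / m) := by ring
    have e3 : 2 * A / m = 2 * (A / m) := by ring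
    have h3 : W / s * (2 * C₁) ≤ 1 := by
      refine le_trans ?_ hWs
      gcongr
      rw [hC, e2, e3]; linarith
    have h4 : W / s * (B / m) ≤ 1 / 4 := by
      have : W / s * (4 * (B / m)) ≤ 1 := by
        refine le_trans ?_ hWs
        gcongr
        rw [hC, e2, e3]; linarith
      linarith
    rw [e1] at h1
    nlinarith [mul_le_mul_of_nonneg_right h4 hS0]
  have h1 := hfin 1 (Set.right_mem_Icc.2 ht₀1)
  rw [Complex.ofReal_one, one_mul] at h1
  refine h1.trans ?_
  rw [mul_div_assoc C]
  refine mul_le_mul_of_nonneg_right ?_ hWs0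
  have h2 : B * S / m ≤ 4 * B / m := by
    refine div_le_div_of_nonneg_right ?_ hm0.le
    linarith [mul_le_mul_of_nonneg_right hS4 hB0]
  have : 0 ≤ 2 * A / m := by positivity
  rw [hC]
  linarith

/-! ### The solutions of the Gauss equation in terms of the continued hypergeometric function -/

/-- By the identity theorem the chosen continuation is the explicit one. -/
lemma continuation_eqOn {U V : Set ℂ} {f g : ℂ → ℂ} (hU : IsOpen U) (hUn : U.Nonempty)
    (hUV : U ⊆ V) (hV : IsOpen V) (hVc : IsPreconnected V) (hg : DifferentiableOn ℂ g V)
    (hgf : Set.EqOn g f U) : Set.EqOn (continuation U V f) g V := by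
  obtain ⟨h1, h2⟩ := continuation_spec ⟨g, hg, hgf⟩
  obtain ⟨z, hz⟩ := hUn
  refine differentiableOn_eqOn_of_eventuallyEq hV hVc h1 hg (hUV hz) ?_
  filter_upwards [hU.mem_nhds hz] with x hx
  rw [h2 hx, hgf hx]

lemma isOpen_domInf : IsOpen domInf := isOpen_slitPlane.preimage continuous_neg

lemma isPreconnected_domInf : IsPreconnected domInf := by
  have h : domInf = (fun w : ℂ => -w) '' slitPlane := by
    ext w
    exact ⟨fun hw => ⟨-w, hw, by ring⟩, by rintro ⟨v, hv, rfl⟩; simpa [domInf] using hv⟩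
  rw [h]
  exact isPreconnected_slitPlane.image _ (by fun_prop)

lemma isOpen_domOne : IsOpen domOne :=
  isOpen_slitPlane.inter (isOpen_slitPlane.preimage (by fun_prop : Continuous fun w : ℂ => 1 - w))

lemma half_mem_domOne : (1 / 2 : ℂ) ∈ domOne := by
  constructor <;> refine mem_slitPlane_iff.2 (Or.inl ?_) <;> norm_num

lemma isPreconnected_domOne : IsPreconnected domOne := by
  have h1 : StarConvex ℝ (1 / 2 : ℂ) slitPlane := by
    have := starConvex_ofReal_slitPlane (x := 1 / 2) (by norm_num)
    push_cast at this
    exact this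
  have h2 : StarConvex ℝ (1 / 2 : ℂ) {x : ℂ | 1 - x ∈ slitPlane} := by
    intro y hy s t hs ht hst
    have := h1 hy hs ht hst
    have e : 1 - (s • (1 / 2 : ℂ) + t • y) = s • (1 / 2 : ℂ) + t • (1 - y) := by
      have hst' : (s : ℂ) + t = 1 := by exact_mod_cast hst
      simp only [real_smul]
      linear_combination -hst'
    change 1 - (s • (1 / 2 : ℂ) + t • y) ∈ slitPlane
    rwa [e]
  have h3 : StarConvex ℝ (1 / 2 : ℂ) domOne := h1.inter h2
  exact (h3.isPathConnected half_mem_domOne).isConnected.isPreconnected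

lemma inv_mem_cutPlane {x : ℂ} (hx : x ∈ domInf) : x⁻¹ ∈ cutPlane := by
  have h := inv_mem_slitPlane hx
  have e : 1 - x⁻¹ = 1 + (-x)⁻¹ := by rw [inv_neg]; ring
  change 1 - x⁻¹ ∈ slitPlane
  rw [e]
  rcases mem_slitPlane_iff.1 h with h | h
  · exact mem_slitPlane_iff.2 (Or.inl (by rw [add_re, one_re]; linarith))
  · exact mem_slitPlane_iff.2 (Or.inr (by simpa using h))

lemma continuation_inf_eqOn {a b c s : ℂ} (hc : ∀ n : ℕ, c + n ≠ 0) :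
    Set.EqOn (continuation (domInf ∩ {x | 1 < ‖x‖}) domInf
        fun x => (-x) ^ s * ordinaryHypergeometric a b c x⁻¹)
      (fun x => (-x) ^ s * hyp a b c x⁻¹) domInf := by
  refine continuation_eqOn (isOpen_domInf.inter (isOpen_lt continuous_const continuous_norm))
    ⟨-2, ?_, ?_⟩ Set.inter_subset_left isOpen_domInf isPreconnected_domInf ?_ ?_
  · exact mem_slitPlane_iff.2 (Or.inl (by norm_num))
  · simp
  · intro x hx
    refine DifferentiableAt.differentiableWithinAt ?_
    have hx0 : x ≠ 0 := by simpa using slitPlane_ne_zero hx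
    refine ((differentiableAt_id.neg).cpow (differentiableAt_const _) hx).mul ?_
    exact ((differentiableOn_hyp hc).differentiableAt
      (isOpen_cutPlane.mem_nhds (inv_mem_cutPlane hx))).comp x (differentiableAt_inv hx0)
  · intro x hx
    have hx1 : x⁻¹ ∈ Metric.ball (0 : ℂ) 1 := by
      rw [mem_ball_zero_iff, norm_inv]
      exact inv_lt_one_of_one_lt₀ hx.2
    simp only [hyp_eqOn_ball hc hx1]

lemma continuation_one_eqOn {a b c s : ℂ} (hc : ∀ n : ℕ, c + n ≠ 0) :
    Set.EqOn (continuation (domOne ∩ {x | ‖1 - x‖ < 1}) domOne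
        fun x => (1 - x) ^ s * ordinaryHypergeometric a b c (1 - x))
      (fun x => (1 - x) ^ s * hyp a b c (1 - x)) domOne := by
  refine continuation_eqOn (isOpen_domOne.inter (isOpen_lt (by fun_prop) continuous_const))
    ⟨1 / 2, half_mem_domOne, by norm_num⟩ Set.inter_subset_left isOpen_domOne
    isPreconnected_domOne ?_ ?_
  · intro x hx
    refine DifferentiableAt.differentiableWithinAt ?_
    have hd : DifferentiableAt ℂ (fun x : ℂ => 1 - x) x := by fun_prop
    have hx1 : 1 - x ∈ cutPlane := by simpa [cutPlane] using hx.1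
    refine (hd.cpow (differentiableAt_const _) hx.2).mul ?_
    exact DifferentiableAt.comp x ((differentiableOn_hyp hc).differentiableAt
      (isOpen_cutPlane.mem_nhds hx1)) hd
  · intro x hx
    simp only [hyp_eqOn_ball hc (mem_ball_zero_iff.2 hx.2)]

section Representations

variable {α β γ x : ℂ}

lemma gaussInf_one_eq (hc : ∀ n : ℕ, β + 1 - α + n ≠ 0) (hx : x ∈ domInf) :
    gaussInf α β γ 1 x = (-x) ^ (-β) * hyp β (β + 1 - γ) (β + 1 - α) x⁻¹ :=
  continuation_inf_eqOn hc hx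

/-- Euler's transformation makes the first two parameters independent of `α`. -/
lemma gaussInf_zero_eq (hc : ∀ n : ℕ, α + 1 - β + n ≠ 0) (hx : x ∈ domInf) :
    gaussInf α β γ 0 x = (-x) ^ (-α) * (1 - x⁻¹) ^ (γ - α - β) *
      hyp (1 - β) (γ - β) (α + 1 - β) x⁻¹ := by
  have h : gaussInf α β γ 0 x = (-x) ^ (-α) * hyp α (α + 1 - γ) (α + 1 - β) x⁻¹ :=
    continuation_inf_eqOn hc hx
  have e1 : α + 1 - β - α - (α + 1 - γ) = γ - α - β := by ring
  have e2 : α + 1 - β - α = 1 - β := by ring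
  have e3 : α + 1 - β - (α + 1 - γ) = γ - β := by ring
  rw [h, hyp_euler hc (inv_mem_cutPlane hx), e1, e2, e3, mul_assoc]

lemma one_sub_div_neg_eq (hx : x ∈ domOne) : (1 - x) / (1 - x - 1) = 1 - x⁻¹ := by
  have hx0 : x ≠ 0 := slitPlane_ne_zero hx.1
  have : 1 - x - 1 = -x := by ring
  rw [this]
  field_simp
  ring

/-- Pfaff's transformation makes the first two parameters independent of `α`. -/
lemma gaussOne_one_eq (hc : ∀ n : ℕ, α + β + 1 - γ + n ≠ 0) (hx : x ∈ domOne) :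
    gaussOne α β γ 1 x = x ^ (-β) * hyp β (β + 1 - γ) (α + β + 1 - γ) (1 - x⁻¹) := by
  have h0 : gaussOneLocal α β γ 1 =
      fun x => (1 - x) ^ (0 : ℂ) * ordinaryHypergeometric α β (α + β + 1 - γ) (1 - x) := by
    ext x; simp [gaussOneLocal]
  have h : gaussOne α β γ 1 x = (1 - x) ^ (0 : ℂ) * hyp α β (α + β + 1 - γ) (1 - x) := by
    rw [gaussOne, h0]
    exact continuation_one_eqOn hc hx
  have hx1 : 1 - x ∈ cutPlane := by simpa [cutPlane] using hx.1
  rw [h, cpow_zero, one_mul, hyp_pfaff hc hx1, one_sub_div_neg_eq hx, sub_sub_cancel,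
    hyp_symm β]
  congr 2
  ring

lemma gaussOne_zero_eq (hc : ∀ n : ℕ, γ + 1 - α - β + n ≠ 0) (hx : x ∈ domOne) :
    gaussOne α β γ 0 x = (1 - x) ^ (γ - α - β) * x ^ (β - γ) *
      hyp (1 - β) (γ - β) (γ + 1 - α - β) (1 - x⁻¹) := by
  have h : gaussOne α β γ 0 x = (1 - x) ^ (γ - α - β) *
      hyp (γ - α) (γ - β) (γ + 1 - α - β) (1 - x) := continuation_one_eqOn hc hx
  have hx1 : 1 - x ∈ cutPlane := by simpa [cutPlane] using hx.1
  have e1 : γ + 1 - α - β - (γ - α) = 1 - β := by ring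
  rw [h, hyp_pfaff hc hx1, one_sub_div_neg_eq hx, sub_sub_cancel, e1, neg_sub, mul_assoc]

end Representations

/-! ### Limits along the imaginary rays -/

section Ray

variable {θ : ℝ}

lemma tendsto_norm_ray (θ : ℝ) : Tendsto (fun α : ℂ => ‖α‖) (ray θ) atTop :=
  (tendsto_norm_cocompact_atTop).mono_left inf_le_left

lemma eventually_arg_eq_ray (θ : ℝ) : ∀ᶠ α in ray θ, α.arg = θ :=
  (show ray θ ≤ 𝓟 {α : ℂ | α.arg = θ} from inf_le_right) (mem_principal_self _)

lemma tendsto_inv_ray (θ : ℝ) : Tendsto (fun α : ℂ => α⁻¹) (ray θ) (𝓝[≠] 0) := by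
  refine tendsto_nhdsWithin_iff.2 ⟨?_, ?_⟩
  · refine tendsto_inv₀_cobounded.mono_left ?_
    rw [Metric.cobounded_eq_cocompact]
    exact inf_le_left
  · filter_upwards [(tendsto_norm_ray θ).eventually_gt_atTop 0] with α hα
    exact inv_ne_zero (norm_pos_iff.1 hα)

lemma tendsto_div_ray (θ : ℝ) (z : ℂ) : Tendsto (fun α : ℂ => z / α) (ray θ) (𝓝 0) := by
  have := ((tendsto_inv_ray θ).mono_right nhdsWithin_le_nhds).const_mul z
  simpa [div_eq_mul_inv] using this

lemma re_eq_zero_of_arg (hθ : |θ| = Real.pi / 2) {α : ℂ} (hα : α.arg = θ) : α.re = 0 := by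
  rcases (abs_eq Real.pi_div_two_pos.le).1 hθ with h | h
  · exact (arg_eq_pi_div_two_iff.1 (hα.trans h)).1
  · exact (arg_eq_neg_pi_div_two_iff.1 (hα.trans h)).1

/-- Points `α` of an imaginary ray with `‖α‖ ≥ R`. -/
lemma eventually_imaginary_ray (hθ : |θ| = Real.pi / 2) (R : ℝ) :
    ∀ᶠ α in ray θ, α.re = 0 ∧ |α.im| = ‖α‖ ∧ R ≤ ‖α‖ ∧ 0 < ‖α‖ := by
  filter_upwards [eventually_arg_eq_ray θ, (tendsto_norm_ray θ).eventually_ge_atTop R,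
    (tendsto_norm_ray θ).eventually_gt_atTop 0] with α h1 h2 h3
  have hre := re_eq_zero_of_arg hθ h1
  exact ⟨hre, abs_im_eq_norm.2 hre, h2, h3⟩

lemma tendsto_mul_log_one_sub_div_ray (θ : ℝ) (z : ℂ) :
    Tendsto (fun α : ℂ => α * log (1 - z / α)) (ray θ) (𝓝 (-z)) := by
  have h : HasDerivAt (fun h : ℂ => log (1 - z * h)) (-z) 0 := by
    have h1 : HasDerivAt (fun h : ℂ => 1 - z * h) (-z) 0 := by
      simpa using ((hasDerivAt_id' (0 : ℂ)).const_mul z).const_sub 1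
    simpa using h1.clog (by simp)
  have := h.tendsto_slope_zero.comp (tendsto_inv_ray θ)
  simpa [Function.comp_def, div_eq_mul_inv] using this

lemma tendsto_one_sub_div_cpow_ray (θ : ℝ) (z s : ℂ) :
    Tendsto (fun α : ℂ => (1 - z / α) ^ (s - α)) (ray θ) (𝓝 (exp z)) := by
  have h1 : Tendsto (fun α : ℂ => 1 - z / α) (ray θ) (𝓝 1) := by
    simpa using (tendsto_div_ray θ z).const_sub 1
  have h2 : Tendsto (fun α : ℂ => log (1 - z / α)) (ray θ) (𝓝 0) := by
    have := h1.clog one_mem_slitPlane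
    rwa [log_one] at this
  have h3 := ((h2.mul_const s).sub (tendsto_mul_log_one_sub_div_ray θ z)).cexp
  rw [zero_mul, zero_sub, neg_neg] at h3
  refine h3.congr' ?_
  filter_upwards [h1.eventually_ne one_ne_zero] with α hα
  rw [cpow_def_of_ne_zero hα]
  congr 1
  ring

/-- For `α` on an imaginary ray the arguments `c = c₀ + e α` and `w = d - e α / r` of the
hypergeometric function lie in the range of `exists_hyp_sub_one_bound`. -/
lemma exists_hyp_ray_bound (hθ : |θ| = Real.pi / 2) (a b c₀ : ℂ) {e d : ℝ} (he : |e| = 1)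
    (hd : |d| ≤ 1) : ∃ C R : ℝ, 0 < R ∧ ∀ r, R ≤ r → ∀ᶠ α in ray θ,
      ‖hyp a b (c₀ + e * α) (d - e * α / r) - 1‖ ≤ C / r := by
  obtain ⟨C, S₀, hC, hS₀, h⟩ := exists_hyp_sub_one_bound a b |c₀.re|
  refine ⟨4 * C, 4 * C + 1, by positivity, fun r hr => ?_⟩
  have hr0 : 0 < r := by linarith
  filter_upwards [eventually_imaginary_ray hθ (2 * |c₀.im| + 2 * S₀ + r + 1)] with α hα
  obtain ⟨hre, him, hs, hs0⟩ := hα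
  set s := ‖α‖ with hsdef
  have hci : (c₀ + e * α).im = c₀.im + e * α.im := by simp
  have hcr : (c₀ + e * α).re = c₀.re := by simp [hre]
  have hwi : ((d : ℂ) - e * α / r).im = -(e * α.im) / r := by
    rw [sub_im, ofReal_im, div_ofReal_im, im_ofReal_mul]
    ring
  have hes : |e * α.im| = s := by rw [abs_mul, he, one_mul, him]
  have hci0 := abs_nonneg c₀.im
  have hcim : s / 2 ≤ |(c₀ + e * α).im| := by
    rw [hci]
    have h1 := abs_sub_abs_le_abs_sub (e * α.im) (-c₀.im)
    rw [hes, abs_neg, sub_neg_eq_add, add_comm] at h1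
    rw [add_comm] at h1
    have h2 : |e * α.im + c₀.im| = |c₀.im + e * α.im| := by rw [add_comm]
    linarith
  have hwim : |((d : ℂ) - e * α / r).im| = s / r := by
    rw [hwi, abs_div, abs_neg, hes, abs_of_pos hr0]
  have hsr : 1 ≤ s / r := by rw [one_le_div hr0]; linarith
  have hw : ‖(d : ℂ) - e * α / r‖ ≤ 2 * (s / r) := by
    have h1 : ‖(d : ℂ) - e * α / r‖ ≤ ‖(d : ℂ)‖ + ‖e * α / r‖ := norm_sub_le _ _
    rw [norm_div, norm_mul, norm_real, norm_real, norm_real, Real.norm_eq_abs, Real.norm_eq_abs,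
      he, one_mul, Real.norm_of_nonneg hr0.le] at h1
    linarith
  have hw1 : 1 ≤ ‖(d : ℂ) - e * α / r‖ := by
    refine hsr.trans ?_
    rw [← hwim]
    exact abs_im_le_norm _
  have hsign : (c₀ + e * α).im * ((d : ℂ) - e * α / r).im < 0 := by
    have e1 : (c₀ + e * α).im * ((d : ℂ) - e * α / r).im =
        -((c₀.im + e * α.im) * (e * α.im) / r) := by rw [hci, hwi]; ring
    rw [e1, neg_lt_zero]
    refine div_pos ?_ hr0
    have h1 : (e * α.im) * (e * α.im) = s * s := by
      rw [← abs_mul_abs_self, hes]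
    have h2 : -(|c₀.im| * s) ≤ c₀.im * (e * α.im) := by
      rw [← hes, ← abs_mul]; exact neg_abs_le _
    have h3 : |c₀.im| * s < s * s := by
      refine mul_lt_mul_of_pos_right ?_ hs0
      linarith
    linarith
  have hCw : C * ‖(d : ℂ) - e * α / r‖ ≤ s / 2 := by
    calc C * ‖(d : ℂ) - e * α / r‖ ≤ C * (2 * (s / r)) := by gcongr
      _ = 2 * C * s / r := by ring
      _ ≤ s / 2 := by
        rw [div_le_iff₀ hr0]
        have := mul_le_mul_of_nonneg_left (show 4 * C ≤ r by linarith) hs0.le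
        linarith
  refine (h _ _ (by rw [hcr]) (by linarith) hsign
    (by rw [hwim]; exact hw) hw1 (hCw.trans hcim)).trans ?_
  calc C * ‖(d : ℂ) - e * α / r‖ / |(c₀ + e * α).im| ≤ C * (2 * (s / r)) / (s / 2) := by
        gcongr
    _ = 4 * C / r := by field_simp; ring

/-- If `n α h r α` converges as `α → ∞` for each `r`, where `h r` is within `C / r` of `1` and the
limit tends to `1` as `r → ∞`, then `n` converges to `1`. -/
lemma tendsto_one_of_approx {l : Filter ℂ} {n : ℂ → ℂ} {h : ℝ → ℂ → ℂ} {Y : ℝ → ℂ} {C R : ℝ}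
    (h1 : ∀ r, R ≤ r → ∀ᶠ α in l, ‖h r α - 1‖ ≤ C / r)
    (h2 : ∀ r, R ≤ r → Tendsto (fun α => n α * h r α) l (𝓝 (Y r)))
    (h3 : Tendsto Y atTop (𝓝 1)) : Tendsto n l (𝓝 1) := by
  rw [Metric.tendsto_nhds]
  intro ε hε
  set δ : ℝ := min (ε / 8) (1 / 2) with hδ
  have hδ0 : 0 < δ := by positivity
  have hδ1 : δ ≤ ε / 8 := min_le_left _ _
  have hδ2 : δ ≤ 1 / 2 := min_le_right _ _
  have hC : Tendsto (fun r : ℝ => C / r) atTop (𝓝 0) := tendsto_const_nhds.div_atTop tendsto_id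
  obtain ⟨r, hr1, hr2, hr3⟩ := ((eventually_ge_atTop R).and ((hC.eventually_lt_const hδ0).and
    ((Metric.tendsto_nhds.1 h3) δ hδ0))).exists
  filter_upwards [h1 r hr1, (Metric.tendsto_nhds.1 (h2 r hr1)) δ hδ0] with α hα1 hα2
  rw [dist_eq_norm] at hr3 hα2 ⊢
  have e1 : ‖h r α - 1‖ ≤ δ := hα1.trans hr2.le
  have e2 : 1 / 2 ≤ ‖h r α‖ := by
    have : ‖(1 : ℂ)‖ ≤ ‖h r α‖ + ‖h r α - 1‖ := by
      simpa using norm_sub_le (h r α) (h r α - 1)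
    rw [norm_one] at this
    linarith
  have e3 : ‖(n α - 1) * h r α‖ ≤ 3 * δ := by
    have : (n α - 1) * h r α = (n α * h r α - Y r) + (Y r - 1) - (h r α - 1) := by ring
    rw [this]
    refine (norm_sub_le _ _).trans ?_
    have := norm_add_le (n α * h r α - Y r) (Y r - 1)
    linarith
  rw [norm_mul] at e3
  have e4 := mul_le_mul_of_nonneg_left e2 (norm_nonneg (n α - 1))
  linarith

end Ray

/-! ### Confluence along the recessive directions -/

/-- The point of the Riemann surface of the logarithm with modulus `r` and argument `φ`. -/
noncomputable def rayPoint (r φ : ℝ) : ℂ := Real.log r + φ * I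

lemma rayPoint_re (r φ : ℝ) : (rayPoint r φ).re = Real.log r := by simp [rayPoint]

lemma rayPoint_im (r φ : ℝ) : (rayPoint r φ).im = φ := by simp [rayPoint]

lemma exp_rayPoint {r φ : ℝ} {τ : ℂ} (hr : 0 < r) (hτ : exp (φ * I) = τ) :
    exp (rayPoint r φ) = τ * r := by
  rw [rayPoint, exp_add, hτ, ← ofReal_exp, Real.exp_log hr, mul_comm]

lemma formalFactor_ne_zero (β γ : ℂ) (j : Fin 2) (ζ : ℂ) : formalFactor β γ j ζ ≠ 0 := by
  fin_cases j <;> simp [formalFactor, exp_ne_zero]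

/-- The leading term of the asymptotic expansion, along a ray inside the sector. -/
lemma IsKummerSectorial.tendsto_div {β γ : ℂ} {j : Fin 2} {k : ℤ} {f : ℂ → ℂ}
    (hf : IsKummerSectorial β γ j k f) {η φ : ℝ} (hη : 0 < η)
    (hφ : φ - k * Real.pi ∈ Set.Ioo (η - Real.pi / 2) (3 * Real.pi / 2 - η)) :
    Tendsto (fun r => f (rayPoint r φ) / formalFactor β γ j (rayPoint r φ)) atTop (𝓝 1) := by
  have h := hf.expansion η hη 1
  have h0 : formalCoeff β γ j 0 = 1 := by fin_cases j <;> simp [formalCoeff]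
  have ht : Tendsto (fun r => rayPoint r φ) atTop (atInfty k η) := by
    refine tendsto_inf.2 ⟨tendsto_comap_iff.2 ?_, tendsto_principal.2 (Eventually.of_forall ?_)⟩
    · simpa [Function.comp_def, rayPoint_re] using Real.tendsto_log_atTop
    · intro r
      simp only [closedSubsector, Set.mem_ofPred_eq, rayPoint_im]
      exact Set.Ioo_subset_Icc_self hφ
  have h2 : Tendsto ((fun ζ : ℂ => Real.exp (-((1 : ℕ) : ℝ) * ζ.re)) ∘ fun r => rayPoint r φ)
      atTop (𝓝 0) := by
    refine (Real.tendsto_exp_neg_atTop_nhds_zero.comp Real.tendsto_log_atTop).congr fun r => ?_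
    simp [rayPoint_re]
  have h3 := ((h.comp_tendsto ht).trans_tendsto h2).add_const 1
  rw [zero_add] at h3
  refine h3.congr fun r => ?_
  simp [h0]

lemma ScaledLimit.tendsto {θ : ℝ} {σ : ℂ → Set ℂ} {S : Set ℂ} {y : ℂ → ℂ → ℂ} {κ f : ℂ → ℂ}
    (h : ScaledLimit θ σ S y κ f) {ζ : ℂ} (hζ : ζ ∈ S) (hσ : ∀ᶠ α in ray θ, ζ ∈ σ α) :
    Tendsto (fun α => y α (exp ζ / α) * κ α) (ray θ) (𝓝 (f ζ)) := by
  rw [Metric.tendsto_nhds]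
  intro ε hε
  filter_upwards [h {ζ} (Set.singleton_subset_iff.2 hζ) isCompact_singleton ε hε, hσ] with α h1 h2
  rw [dist_eq_norm]
  exact h1 ζ rfl h2

section Sectors

variable {θ η φ r : ℝ}

lemma eventually_arg_one_sub_mem (hη : η < Real.pi) (z : ℂ) :
    ∀ᶠ α in ray θ, (1 - z / α).arg ∈ Set.Ioo (η - Real.pi) (Real.pi - η) := by
  have h1 : Tendsto (fun α : ℂ => 1 - z / α) (ray θ) (𝓝 1) := by
    simpa using (tendsto_div_ray θ z).const_sub 1
  have h2 := (continuousAt_arg one_mem_slitPlane).tendsto.comp h1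
  rw [arg_one] at h2
  exact h2.eventually (Ioo_mem_nhds (by linarith) (by linarith))

lemma eventually_mem_sigmaInf (hη : η < Real.pi)
    (h : φ - θ - Real.pi ∈ Set.Ioo (η - Real.pi) (Real.pi - η)) :
    ∀ᶠ α in ray θ, rayPoint r φ ∈ sigmaInf η α := by
  filter_upwards [eventually_arg_eq_ray θ, eventually_arg_one_sub_mem hη (exp (rayPoint r φ))]
    with α h1 h2
  exact ⟨by rw [rayPoint_im, h1]; exact h, h2⟩

lemma eventually_mem_sigmaOne (hη : η < Real.pi)
    (h : φ - θ ∈ Set.Ioo (η - Real.pi) (Real.pi - η)) :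
    ∀ᶠ α in ray θ, rayPoint r φ ∈ sigmaOne η α := by
  filter_upwards [eventually_arg_eq_ray θ, eventually_arg_one_sub_mem hη (exp (rayPoint r φ)),
    (tendsto_norm_ray θ).eventually_ge_atTop (2 + 1 / ‖exp (rayPoint r φ)‖)] with α h1 h2 h3
  refine ⟨?_, by rw [rayPoint_im, h1]; exact h, h2⟩
  have h4 : ‖1 - α / exp (rayPoint r φ)‖ ≤ 1 + ‖α‖ / ‖exp (rayPoint r φ)‖ := by
    simpa using norm_sub_le 1 (α / exp (rayPoint r φ))
  have h5 : 0 ≤ 1 / ‖exp (rayPoint r φ)‖ := by positivity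
  refine h4.trans_lt ?_
  rw [div_eq_mul_one_div]
  nlinarith

/-- On `σ_∞(α)` the principal powers of `-z / α` are the products of the powers of `z` and `-α` with
the arguments `arg z` and `arg α + π`. -/
lemma neg_div_cpow {α ζ : ℂ} (hα : α ≠ 0)
    (h : ζ.im - α.arg - Real.pi ∈ Set.Ioo (-Real.pi) Real.pi) (s : ℂ) :
    (-(exp ζ / α)) ^ s = exp (s * ζ) * negPow α (-s) := by
  have e : -(exp ζ / α) = exp (ζ - log α - Real.pi * I) := by
    rw [exp_sub, exp_sub, exp_log hα, exp_pi_mul_I]; ring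
  have him : (ζ - log α - Real.pi * I).im = ζ.im - α.arg - Real.pi := by simp [log_im]
  rw [cpow_def_of_ne_zero (by rw [e]; exact exp_ne_zero _), e,
    log_exp (by rw [him]; exact h.1) (by rw [him]; exact h.2.le), negPow, ← exp_add]
  congr 1
  ring

lemma div_cpow_of_im_sub_arg {α ζ : ℂ} (hα : α ≠ 0)
    (h : ζ.im - α.arg ∈ Set.Ioo (-Real.pi) Real.pi) (s : ℂ) :
    (exp ζ / α) ^ s = exp (s * ζ) * α ^ (-s) := by
  have e : exp ζ / α = exp (ζ - log α) := by rw [exp_sub, exp_log hα]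
  have him : (ζ - log α).im = ζ.im - α.arg := by simp [log_im]
  rw [cpow_def_of_ne_zero (by rw [e]; exact exp_ne_zero _), e,
    log_exp (by rw [him]; exact h.1) (by rw [him]; exact h.2.le), cpow_def_of_ne_zero hα, ← exp_add]
  congr 1
  ring

/-- The principal logarithm of `1 - 1/x = (1 - x) / (-x)` is the difference of the logarithms as long
as both arguments are at most `π / 2` in modulus. -/
lemma neg_cpow_mul_one_sub_inv_cpow {x : ℂ} (hx : x ≠ 0) (h1 : 0 ≤ (-x).re) (h2 : 0 < (1 - x).re)
    (s t : ℂ) : (-x) ^ s * (1 - x⁻¹) ^ t = (1 - x) ^ t * (-x) ^ (s - t) := by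
  have hx' : -x ≠ 0 := neg_ne_zero.2 hx
  have hx1 : 1 - x ≠ 0 := fun h => by rw [h] at h2; simp at h2
  have e : 1 - x⁻¹ = exp (log (1 - x) - log (-x)) := by
    rw [exp_sub, exp_log hx', exp_log hx1]; field_simp; ring
  have a1 := abs_le.1 (abs_arg_le_pi_div_two_iff.2 h1)
  have a2 := abs_lt.1 (abs_arg_lt_pi_div_two_iff.2 (Or.inl h2))
  have him : (log (1 - x) - log (-x)).im = (1 - x).arg - (-x).arg := by simp [log_im]
  rw [cpow_def_of_ne_zero hx', cpow_def_of_ne_zero hx', cpow_def_of_ne_zero hx1,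
    cpow_def_of_ne_zero (x := 1 - x⁻¹) (by rw [e]; exact exp_ne_zero _), e,
    log_exp (by rw [him]; linarith) (by rw [him]; linarith), ← exp_add, ← exp_add]
  congr 1
  ring

lemma eventually_add_mul_add_nat_ne_zero (hθ : |θ| = Real.pi / 2) (c₀ : ℂ) {e : ℝ} (he : |e| = 1) :
    ∀ᶠ α in ray θ, ∀ n : ℕ, c₀ + e * α + n ≠ 0 := by
  filter_upwards [eventually_imaginary_ray hθ (|c₀.im| + 1)] with α hα
  obtain ⟨-, him, hs, -⟩ := hα
  refine add_nat_ne_zero_of_im_ne_zero fun h => ?_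
  have h1 : c₀.im + e * α.im = 0 := by simpa using h
  have h2 : |e * α.im| = |c₀.im| := by rw [← abs_neg c₀.im]; congr 1; linarith
  rw [abs_mul, he, one_mul, him] at h2
  linarith

/-- For `α` on an imaginary ray and `z` real, `z / α` is imaginary. -/
lemma eventually_div_imaginary (hθ : |θ| = Real.pi / 2) {z : ℝ} (hz : z ≠ 0) :
    ∀ᶠ α in ray θ, ((z : ℂ) / α).re = 0 ∧ ((z : ℂ) / α).im ≠ 0 := by
  filter_upwards [eventually_imaginary_ray hθ 0] with α hα
  obtain ⟨hre, him, -, hs⟩ := hα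
  have h0 : α ≠ 0 := norm_pos_iff.1 hs
  have h1 : ((z : ℂ) / α).re = 0 := by simp [div_re, hre]
  refine ⟨h1, fun h => ?_⟩
  have h2 : (z : ℂ) / α = 0 := Complex.ext h1 h
  exact (div_ne_zero (by exact_mod_cast hz) h0) h2

lemma mem_domInf_of_im_ne_zero {x : ℂ} (hx : x.im ≠ 0) : x ∈ domInf :=
  mem_slitPlane_iff.2 (Or.inr (by simpa using hx))

lemma mem_domOne_of_im_ne_zero {x : ℂ} (hx : x.im ≠ 0) : x ∈ domOne :=
  ⟨mem_slitPlane_iff.2 (Or.inr hx), mem_slitPlane_iff.2 (Or.inr (by simpa using hx))⟩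

end Sectors

section Limits

variable {β γ : ℂ} {θ η φ : ℝ} {k : ℤ} {κ f : ℂ → ℂ}

/-- The solutions `y α` are a factor `E r α`, which converges to the leading factor of `f`, times a
normalisation `ν α` times a hypergeometric function that is close to `1`; then `κ ν → 1`. -/
lemma tendsto_normalisation (hθ : |θ| = Real.pi / 2) {σ : ℂ → Set ℂ} {S : Set ℂ} {y : ℂ → ℂ → ℂ}
    {ff ν : ℂ → ℂ} {E : ℝ → ℂ → ℂ} {a b c₀ : ℂ} {e d : ℝ} (he : |e| = 1) (hd : |d| ≤ 1)
    (hlim : ScaledLimit θ σ S y κ f) (hS : ∀ r, rayPoint r φ ∈ S)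
    (hσ : ∀ r, ∀ᶠ α in ray θ, rayPoint r φ ∈ σ α)
    (hy : ∀ r, 0 < r → ∀ᶠ α in ray θ, y α (exp (rayPoint r φ) / α) =
      E r α * ν α * hyp a b (c₀ + e * α) (d - e * α / r))
    (hff : ∀ ζ, ff ζ ≠ 0)
    (hE : ∀ r, 0 < r → Tendsto (E r) (ray θ) (𝓝 (ff (rayPoint r φ))))
    (hY : Tendsto (fun r => f (rayPoint r φ) / ff (rayPoint r φ)) atTop (𝓝 1)) :
    Tendsto (fun α => κ α * ν α) (ray θ) (𝓝 1) := by
  obtain ⟨C, R, hR, hbound⟩ := exists_hyp_ray_bound hθ a b c₀ he hd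
  refine tendsto_one_of_approx hbound (fun r hr => ?_) hY
  have hr0 := hR.trans_le hr
  refine ((hlim.tendsto (hS r) (hσ r)).div (hE r hr0) (hff _)).congr' ?_
  filter_upwards [hy r hr0, (hE r hr0).eventually_ne (hff _)] with α h1 h2
  simp only [Pi.div_apply]
  rw [h1]
  field_simp

lemma tendsto_gaussInf_one (hθ : |θ| = Real.pi / 2) (hη : 0 < η) (hη' : η < Real.pi)
    (hf : IsKummerSectorial β γ 1 k f)
    (hlim : ScaledLimit θ (sigmaInf η) (sectorS η k) (fun α => gaussInf α β γ 1) κ f)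
    (hτ : exp (φ * I) = 1)
    (h1 : φ - k * Real.pi ∈ Set.Ioo (η - Real.pi / 2) (3 * Real.pi / 2 - η))
    (h2 : φ - θ - Real.pi ∈ Set.Ioo (η - Real.pi) (Real.pi - η)) :
    Tendsto (fun α => -κ α * negPow α β) (ray θ) (𝓝 1) := by
  have key := tendsto_normalisation (φ := φ) (ν := fun α => -negPow α β)
    (E := fun r _ => formalFactor β γ 1 (rayPoint r φ)) (a := β) (b := β + 1 - γ) (c₀ := β + 1)
    (e := -1) (d := 0) hθ (by simp) (by simp) hlim
    (fun r => by rw [sectorS, Set.mem_ofPred_eq, rayPoint_im]; exact h1)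
    (fun r => eventually_mem_sigmaInf hη' h2) ?_ (formalFactor_ne_zero β γ 1)
    (fun r _ => tendsto_const_nhds) (hf.tendsto_div hη h1)
  · exact key.congr fun α => by ring
  intro r hr
  have hx := eventually_div_imaginary hθ hr.ne'
  filter_upwards [hx, eventually_arg_eq_ray θ, eventually_imaginary_ray hθ 0,
    eventually_add_mul_add_nat_ne_zero hθ (β + 1) (e := -1) (by simp)] with α hα harg hα0 hc
  have hα0' : α ≠ 0 := norm_pos_iff.1 hα0.2.2.2
  have e1 : exp (rayPoint r φ) = r := by rw [exp_rayPoint hr hτ, one_mul]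
  have e2 : β + 1 + ((-1 : ℝ) : ℂ) * α = β + 1 - α := by push_cast; ring
  have e3 : ((0 : ℝ) : ℂ) - ((-1 : ℝ) : ℂ) * α / r = ((r : ℂ) / α)⁻¹ := by
    rw [inv_div]; push_cast; ring
  rw [e2] at hc
  rw [e2, e3, ← e1, gaussInf_one_eq hc (by rw [e1]; exact mem_domInf_of_im_ne_zero hα.2),
    neg_div_cpow hα0' (by
      rw [rayPoint_im, harg]; exact ⟨by linarith [h2.1], by linarith [h2.2]⟩), neg_neg]
  simp [formalFactor]

lemma tendsto_gaussOne_one (hθ : |θ| = Real.pi / 2) (hη : 0 < η) (hη' : η < Real.pi)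
    (hf : IsKummerSectorial β γ 1 k f)
    (hlim : ScaledLimit θ (sigmaOne η) (sectorS η k) (fun α => gaussOne α β γ 1) κ f)
    (hτ : exp (φ * I) = 1)
    (h1 : φ - k * Real.pi ∈ Set.Ioo (η - Real.pi / 2) (3 * Real.pi / 2 - η))
    (h2 : φ - θ ∈ Set.Ioo (η - Real.pi) (Real.pi - η)) :
    Tendsto (fun α => -κ α * α ^ β) (ray θ) (𝓝 1) := by
  have key := tendsto_normalisation (φ := φ) (ν := fun α => -α ^ β)
    (E := fun r _ => formalFactor β γ 1 (rayPoint r φ)) (a := β) (b := β + 1 - γ)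
    (c₀ := β + 1 - γ) (e := 1) (d := 1) hθ (by simp) (by simp) hlim
    (fun r => by rw [sectorS, Set.mem_ofPred_eq, rayPoint_im]; exact h1)
    (fun r => eventually_mem_sigmaOne hη' h2) ?_ (formalFactor_ne_zero β γ 1)
    (fun r _ => tendsto_const_nhds) (hf.tendsto_div hη h1)
  · exact key.congr fun α => by ring
  intro r hr
  have hx := eventually_div_imaginary hθ hr.ne'
  filter_upwards [hx, eventually_arg_eq_ray θ, eventually_imaginary_ray hθ 0,
    eventually_add_mul_add_nat_ne_zero hθ (β + 1 - γ) (e := 1) (by simp)] with α hα harg hα0 hc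
  have hα0' : α ≠ 0 := norm_pos_iff.1 hα0.2.2.2
  have e1 : exp (rayPoint r φ) = r := by rw [exp_rayPoint hr hτ, one_mul]
  have e2 : β + 1 - γ + ((1 : ℝ) : ℂ) * α = α + β + 1 - γ := by push_cast; ring
  have e3 : ((1 : ℝ) : ℂ) - ((1 : ℝ) : ℂ) * α / r = 1 - ((r : ℂ) / α)⁻¹ := by
    rw [inv_div]; push_cast; ring
  rw [e2] at hc
  rw [e2, e3, ← e1, gaussOne_one_eq hc (by rw [e1]; exact mem_domOne_of_im_ne_zero hα.2),
    div_cpow_of_im_sub_arg hα0' (by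
      rw [rayPoint_im, harg]; exact ⟨by linarith [h2.1], by linarith [h2.2]⟩), neg_neg]
  simp [formalFactor]

lemma tendsto_gaussInf_zero (hθ : |θ| = Real.pi / 2) (hη : 0 < η) (hη' : η < Real.pi)
    (hf : IsKummerSectorial β γ 0 k f)
    (hlim : ScaledLimit θ (sigmaInf η) (sectorS η k) (fun α => gaussInf α β γ 0) κ f)
    (hτ : exp (φ * I) = -1)
    (h1 : φ - k * Real.pi ∈ Set.Ioo (η - Real.pi / 2) (3 * Real.pi / 2 - η))
    (h2 : φ - θ - Real.pi ∈ Set.Ioo (η - Real.pi) (Real.pi - η)) :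
    Tendsto (fun α => κ α * negPow α (γ - β)) (ray θ) (𝓝 1) := by
  refine tendsto_normalisation (φ := φ) (ν := fun α => negPow α (γ - β))
    (E := fun r α => (1 - exp (rayPoint r φ) / α) ^ (γ - β - α) *
      exp ((β - γ) * rayPoint r φ)) (a := 1 - β) (b := γ - β) (c₀ := 1 - β)
    (e := 1) (d := 0) hθ (by simp) (by simp) hlim
    (fun r => by rw [sectorS, Set.mem_ofPred_eq, rayPoint_im]; exact h1)
    (fun r => eventually_mem_sigmaInf hη' h2) ?_ (formalFactor_ne_zero β γ 0)
    (fun r _ => (tendsto_one_sub_div_cpow_ray θ _ _).mul_const _) (hf.tendsto_div hη h1)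
  intro r hr
  have hx := eventually_div_imaginary hθ (neg_ne_zero.2 hr.ne')
  filter_upwards [hx, eventually_arg_eq_ray θ, eventually_imaginary_ray hθ 0,
    eventually_add_mul_add_nat_ne_zero hθ (1 - β) (e := 1) (by simp)] with α hα harg hα0 hc
  have hα0' : α ≠ 0 := norm_pos_iff.1 hα0.2.2.2
  have e1 : exp (rayPoint r φ) = ((-r : ℝ) : ℂ) := by
    rw [exp_rayPoint hr hτ]; push_cast; ring
  have e2 : 1 - β + ((1 : ℝ) : ℂ) * α = α + 1 - β := by push_cast; ring
  have e3 : ((0 : ℝ) : ℂ) - ((1 : ℝ) : ℂ) * α / r = (((-r : ℝ) : ℂ) / α)⁻¹ := by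
    rw [inv_div]; push_cast; rw [div_neg]; ring
  have hx0 : exp (rayPoint r φ) / α ≠ 0 := div_ne_zero (exp_ne_zero _) hα0'
  rw [e2] at hc
  rw [← e1] at hα
  rw [e2, e3, ← e1, gaussInf_zero_eq hc (mem_domInf_of_im_ne_zero hα.2),
    neg_cpow_mul_one_sub_inv_cpow hx0 (by rw [neg_re, hα.1, neg_zero])
      (by rw [sub_re, hα.1]; norm_num),
    neg_div_cpow hα0' (by
      rw [rayPoint_im, harg]; exact ⟨by linarith [h2.1], by linarith [h2.2]⟩)]
  have e4 : -α - (γ - α - β) = β - γ := by ring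
  have e5 : γ - α - β = γ - β - α := by ring
  rw [e4, e5, neg_sub]
  ring

lemma tendsto_gaussOne_zero (hθ : |θ| = Real.pi / 2) (hη : 0 < η) (hη' : η < Real.pi)
    (hf : IsKummerSectorial β γ 0 k f)
    (hlim : ScaledLimit θ (sigmaOne η) (sectorS η k) (fun α => gaussOne α β γ 0) κ f)
    (hτ : exp (φ * I) = -1)
    (h1 : φ - k * Real.pi ∈ Set.Ioo (η - Real.pi / 2) (3 * Real.pi / 2 - η))
    (h2 : φ - θ ∈ Set.Ioo (η - Real.pi) (Real.pi - η)) :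
    Tendsto (fun α => κ α * α ^ (γ - β)) (ray θ) (𝓝 1) := by
  refine tendsto_normalisation (φ := φ) (ν := fun α => α ^ (γ - β))
    (E := fun r α => (1 - exp (rayPoint r φ) / α) ^ (γ - β - α) *
      exp ((β - γ) * rayPoint r φ)) (a := 1 - β) (b := γ - β) (c₀ := γ + 1 - β)
    (e := -1) (d := 1) hθ (by simp) (by simp) hlim
    (fun r => by rw [sectorS, Set.mem_ofPred_eq, rayPoint_im]; exact h1)
    (fun r => eventually_mem_sigmaOne hη' h2) ?_ (formalFactor_ne_zero β γ 0)
    (fun r _ => (tendsto_one_sub_div_cpow_ray θ _ _).mul_const _) (hf.tendsto_div hη h1)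
  intro r hr
  have hx := eventually_div_imaginary hθ (neg_ne_zero.2 hr.ne')
  filter_upwards [hx, eventually_arg_eq_ray θ, eventually_imaginary_ray hθ 0,
    eventually_add_mul_add_nat_ne_zero hθ (γ + 1 - β) (e := -1) (by simp)] with α hα harg hα0 hc
  have hα0' : α ≠ 0 := norm_pos_iff.1 hα0.2.2.2
  have e1 : exp (rayPoint r φ) = ((-r : ℝ) : ℂ) := by
    rw [exp_rayPoint hr hτ]; push_cast; ring
  have e2 : γ + 1 - β + ((-1 : ℝ) : ℂ) * α = γ + 1 - α - β := by push_cast; ring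
  have e3 : ((1 : ℝ) : ℂ) - ((-1 : ℝ) : ℂ) * α / r = 1 - (((-r : ℝ) : ℂ) / α)⁻¹ := by
    rw [inv_div]; push_cast; rw [div_neg]; ring
  rw [e2] at hc
  rw [← e1] at hα
  have e5 : γ - α - β = γ - β - α := by ring
  rw [e2, e3, ← e1, gaussOne_zero_eq hc (mem_domOne_of_im_ne_zero hα.2),
    div_cpow_of_im_sub_arg hα0' (by
      rw [rayPoint_im, harg]; exact ⟨by linarith [h2.1], by linarith [h2.2]⟩), e5, neg_sub]
  ring

end Limits

end Confluence

theorem theorem2 (β γ : ℂ) (hγ : ∀ n : ℤ, γ ≠ n)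
    (η : ℝ) (hη : η ∈ Set.Ioo 0 (Real.pi / 2))
    (ytilde : Fin 2 → ℤ → ℂ → ℂ)
    (hytilde : ∀ j k, Confluence.IsKummerSectorial β γ j k (ytilde j k))
    (kInfPlus kInfMinus kOnePlus kOneMinus : Fin 2 → ℂ → ℂ)
    (hOneMinus : ∀ j, Confluence.ScaledLimit (-(Real.pi / 2)) (Confluence.sigmaOne η)
      (Confluence.sectorS η (-1)) (fun α => Confluence.gaussOne α β γ j)
      (kOneMinus j) (ytilde j (-1)))
    (hInfMinus : ∀ j, Confluence.ScaledLimit (-(Real.pi / 2)) (Confluence.sigmaInf η)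
      (Confluence.sectorS η 0) (fun α => Confluence.gaussInf α β γ j)
      (kInfMinus j) (ytilde j 0))
    (hOnePlus : ∀ j, Confluence.ScaledLimit (Real.pi / 2) (Confluence.sigmaOne η)
      (Confluence.sectorS η 0) (fun α => Confluence.gaussOne α β γ j)
      (kOnePlus j) (ytilde j 0))
    (hInfPlus : ∀ j, Confluence.ScaledLimit (Real.pi / 2) (Confluence.sigmaInf η)
      (Confluence.sectorS η 1) (fun α => Confluence.gaussInf α β γ j)
      (kInfPlus j) (ytilde j 1)) :
    (Tendsto (fun α => kInfPlus 0 α * Confluence.negPow α (γ - β))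
        (Confluence.ray (Real.pi / 2)) (𝓝 1) ∧
      Tendsto (fun α => kInfMinus 0 α * Confluence.negPow α (γ - β))
        (Confluence.ray (-(Real.pi / 2))) (𝓝 1)) ∧
    (Tendsto (fun α => -kInfPlus 1 α * Confluence.negPow α β)
        (Confluence.ray (Real.pi / 2)) (𝓝 1) ∧
      Tendsto (fun α => -kInfMinus 1 α * Confluence.negPow α β)
        (Confluence.ray (-(Real.pi / 2))) (𝓝 1)) ∧
    (Tendsto (fun α => kOnePlus 0 α * α ^ (γ - β))
        (Confluence.ray (Real.pi / 2)) (𝓝 1) ∧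
      Tendsto (fun α => kOneMinus 0 α * α ^ (γ - β))
        (Confluence.ray (-(Real.pi / 2))) (𝓝 1)) ∧
    (Tendsto (fun α => -kOnePlus 1 α * α ^ β)
        (Confluence.ray (Real.pi / 2)) (𝓝 1) ∧
      Tendsto (fun α => -kOneMinus 1 α * α ^ β)
        (Confluence.ray (-(Real.pi / 2))) (𝓝 1)) := by
  have hπ := Real.pi_pos
  obtain ⟨h0, hη2⟩ := hη
  have hη1 : η < Real.pi := by linarith
  have hp : |Real.pi / 2| = Real.pi / 2 := abs_of_pos (by positivity)
  have hm : |(-(Real.pi / 2))| = Real.pi / 2 := by rw [abs_neg, hp]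
  -- The recessive directions: `arg z` is a multiple of `2 π` for the second solution, where
  -- `z > 0`, and an odd multiple of `π` for the first one, where `z < 0`.
  have t0 : exp (((0 : ℝ) : ℂ) * I) = 1 := by simp
  have t2 : exp (((2 * Real.pi : ℝ) : ℂ) * I) = 1 := by push_cast; exact exp_two_pi_mul_I
  have t1 : exp (((Real.pi : ℝ) : ℂ) * I) = -1 := exp_pi_mul_I
  have t3 : exp (((-Real.pi : ℝ) : ℂ) * I) = -1 := by
    push_cast; rw [neg_mul, exp_neg, exp_pi_mul_I]; norm_num
  refine ⟨⟨?_, ?_⟩, ⟨?_, ?_⟩, ⟨?_, ?_⟩, ⟨?_, ?_⟩⟩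
  · exact Confluence.tendsto_gaussInf_zero hp h0 hη1 (hytilde 0 1) (hInfPlus 0) t1
      ⟨by push_cast; linarith, by push_cast; linarith⟩ ⟨by linarith, by linarith⟩
  · exact Confluence.tendsto_gaussInf_zero hm h0 hη1 (hytilde 0 0) (hInfMinus 0) t1
      ⟨by push_cast; linarith, by push_cast; linarith⟩ ⟨by linarith, by linarith⟩
  · exact Confluence.tendsto_gaussInf_one hp h0 hη1 (hytilde 1 1) (hInfPlus 1) t2
      ⟨by push_cast; linarith, by push_cast; linarith⟩ ⟨by linarith, by linarith⟩
  · exact Confluence.tendsto_gaussInf_one hm h0 hη1 (hytilde 1 0) (hInfMinus 1) t0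
      ⟨by push_cast; linarith, by push_cast; linarith⟩ ⟨by linarith, by linarith⟩
  · exact Confluence.tendsto_gaussOne_zero hp h0 hη1 (hytilde 0 0) (hOnePlus 0) t1
      ⟨by push_cast; linarith, by push_cast; linarith⟩ ⟨by linarith, by linarith⟩
  · exact Confluence.tendsto_gaussOne_zero hm h0 hη1 (hytilde 0 (-1)) (hOneMinus 0) t3
      ⟨by push_cast; linarith, by push_cast; linarith⟩ ⟨by linarith, by linarith⟩
  · exact Confluence.tendsto_gaussOne_one hp h0 hη1 (hytilde 1 0) (hOnePlus 1) t0
      ⟨by push_cast; linarith, by push_cast; linarith⟩ ⟨by linarith, by linarith⟩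
  · exact Confluence.tendsto_gaussOne_one hm h0 hη1 (hytilde 1 (-1)) (hOneMinus 1) t0
      ⟨by push_cast; linarith, by push_cast; linarith⟩ ⟨by linarith, by linarith⟩
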